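/- **Setting.** Let $n\ge 2$, $\eta\in[1,n]$, $\varepsilon\in(0,1]$, let $C\in\mathbb R^{n\times n}$ with $\|C\|_\infty:=\max_{ij}|C_{ij}|\ge 1$, and let $\mathbf p,\mathbf q$ be vectors in the probability simplex $\Delta_n$. Let $\mathcal M(\mathbf p,\mathbf q)$ be the set of entrywise nonnegative $P\in\mathbb R^{n\times n}$ with $P\mathbf 1=\mathbf p$ and $P^\top\mathbf 1=\mathbf q$. For $M\in\mathbb R^{n\times n}$ and a nonnegative matrix $P$ put $$V_M(P)=\sum_{ij}M_{ij}P_{ij}-\eta^{-1}H(P),\qquad H(P)=\sum_{ij}P_{ij}\log\tfrac1{P_{ij}}\quad(0\log\tfrac10=0),$$ and let $P^\eta$ be the minimizer of $V_C$ over $\mathcal M(\mathbf p,\mathbf q)$. Put $$\varepsilon'=\min\Big(1,\ \frac{\varepsilon\eta}{50\,(\|C\|_\infty\eta+\log\frac{n}{\eta\varepsilon})}\Big).$$ Exponentials and logarithms of matrices are entrywise. **Algorithm** $\textsc{Sinkhorn}(\tilde K,\mathbf p,\mathbf q,\delta)$. Set $\tau=\delta/8$, $D_1=D_2=I$, $k=0$,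 $\mathbf p'=(1-\tau)\mathbf p+\frac\tau n\mathbf 1$, $\mathbf q'=(1-\tau)\mathbf q+\frac\tau n\mathbf 1$. While $\|D_1\tilde KD_2\mathbf 1-\mathbf p'\|_1+\|(D_1\tilde KD_2)^\top\mathbf 1-\mathbf q'\|_1>\delta/2$: increase $k$ by one; if $k$ is odd set $(D_1)_{ii}=\mathbf p'_i/(\tilde KD_2\mathbf 1)_i$ for all $i$, otherwise set $(D_2)_{jj}=\mathbf q'_j/((D_1\tilde K)^\top\mathbf 1)_j$ for all $j$. Finally return $D_1$, $D_2$ and $$\hat W=\eta^{-1}\Big(\sum_i\log (D_1)_{ii}\,(D_1\tilde KD_2\mathbf 1)_i+\sum_j\log (D_2)_{jj}\,((D_1\tilde KD_2)^\top\mathbf 1)_j\Big).$$ Running time is counted in exact real arithmetic: a scalar operation (arithmetic, absolute value, logarithm, comparison, assignment, counter operation) takes one step, an entrywise operation on vectors of length $n$ or the sum of such a vector takes $n$ steps, and $\tilde K$ is accessed only through products with $\tilde K$ or $\tilde K^\top$, each of which takes $T_{\mathrm{mult}}$ steps. **Theorem.** The minimizer $P^\eta$ exists and is unique. Let $K=e^{-\eta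 C}$ and let $\tilde K\in\mathbb R_{>0}^{n\times n}$ satisfy $\|\log K-\log\tilde K\|_\infty\le\varepsilon'$. Then $\textsc{Sinkhorn}(\tilde K,\mathbf p,\mathbf q,\varepsilon')$ terminates, and its outputs are positive diagonal matrices $D_1,D_2$ and a number $\hat W$ such that $\tilde P:=D_1\tilde KD_2$ satisfies $$\|\tilde P\mathbf 1-\mathbf p\|_1+\|\tilde P^\top\mathbf 1-\mathbf q\|_1\le\varepsilon',\qquad |V_C(P^\eta)-V_C(\tilde P)|\le\frac\varepsilon2,\qquad |\hat W-V_C(\tilde P)|\le\frac\varepsilon2 .$$ Moreover, the running time is $\tilde O\big((n+T_{\mathrm{mult}})\,\eta\|C\|_\infty\,\varepsilon'^{-1}\big)$, that is, at most $c\,(n+T_{\mathrm{mult}})\,\eta\|C\|_\infty\,\varepsilon'^{-1}\,(\log\frac n\varepsilon)^m$ for universal constants $c>0$ and $m\in\mathbb N$. -/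

import Mathlib

open scoped Matrix.Norms.Elementwise

/-! ## Entropic optimal transport

With the scope opened above, `‖A‖` for a real matrix `A` is the entrywise norm `max_{ij} |A i j|`. -/

namespace EntropicOT

noncomputable section

variable {n : ℕ}

/-- The `ℓ₁` norm of a vector. -/
def l1 (v : Fin n → ℝ) : ℝ := ∑ i, |v i|

/-- Row marginals `P 1`. -/
def rowSum (P : Matrix (Fin n) (Fin n) ℝ) : Fin n → ℝ := P.mulVec 1

/-- Column marginals `Pᵀ 1`. -/
def colSum (P : Matrix (Fin n) (Fin n) ℝ) : Fin n → ℝ := P.transpose.mulVec 1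

/-- The set `M(p, q)` of couplings: nonnegative matrices with `P 1 = p` and `Pᵀ 1 = q`. -/
def couplings (p q : Fin n → ℝ) : Set (Matrix (Fin n) (Fin n) ℝ) :=
  {P | (∀ i j, 0 ≤ P i j) ∧ rowSum P = p ∧ colSum P = q}

/-- Shannon entropy `∑ P i j * log (1 / P i j)`, with `0 * log (1 / 0) = 0`
(`Real.negMulLog x = -x * Real.log x`, which is `0` at `0`). -/
def entropy (P : Matrix (Fin n) (Fin n) ℝ) : ℝ := ∑ i, ∑ j, Real.negMulLog (P i j)

/-- The objective `V_M(P) = ⟨M, P⟩ - η⁻¹ H(P)`. -/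
def objective (η : ℝ) (M P : Matrix (Fin n) (Fin n) ℝ) : ℝ :=
  (∑ i, ∑ j, M i j * P i j) - η⁻¹ * entropy P

/-- `P` is a minimizer of `V_C` over the couplings of `p` and `q`. -/
def IsOptimalCoupling (η : ℝ) (C : Matrix (Fin n) (Fin n) ℝ) (p q : Fin n → ℝ)
    (P : Matrix (Fin n) (Fin n) ℝ) : Prop :=
  P ∈ couplings p q ∧ ∀ Q ∈ couplings p q, objective η C P ≤ objective η C Q

/-- The kernel `K = e^{-η C}`, entrywise. -/
def kernel (η : ℝ) (C : Matrix (Fin n) (Fin n) ℝ) : Matrix (Fin n) (Fin n) ℝ :=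
  Matrix.of fun i j => Real.exp (-η * C i j)

/-- The entrywise logarithm of a matrix. -/
def logEntries (A : Matrix (Fin n) (Fin n) ℝ) : Matrix (Fin n) (Fin n) ℝ := A.map Real.log

/-- The tolerance `ε' = min (1, ε η / (50 (‖C‖ η + log (n / (η ε)))))`. -/
def tolerance (η ε : ℝ) (C : Matrix (Fin n) (Fin n) ℝ) : ℝ :=
  min 1 (ε * η / (50 * (‖C‖ * η + Real.log (n / (η * ε)))))

end

end EntropicOT

/-! ## A small imperative language over the reals with a step count

Programs manipulate real scalars and real vectors of length `n` and have access to a fixed matrix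
`A` only through the products `A v` and `Aᵀ v`. A scalar operation costs `1`, an entrywise vector
operation or the sum of a vector costs `n`, a product with `A` or `Aᵀ` costs `T`.
Programs do not depend on `n`, on `A` or on `T`. -/

namespace MatVecProgram

inductive Ty
  | scalar
  | vec

/-- Scalar variables. -/
inductive SVar
  | delta | eta | tau | What
  deriving DecidableEq

/-- Vector variables. -/
inductive VVar
  | p | q | p' | q' | d1 | d2
  deriving DecidableEq

inductive UnaryOp
  | log | abs

inductive BinaryOp
  | add | sub | mul | div

/-- Expressions; `un` and `bin` act entrywise on vectors. -/
inductive Expr : Ty → Type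
  | lit (k : ℕ) : Expr .scalar
  | dim : Expr .scalar
  | svar (x : SVar) : Expr .scalar
  | vvar (x : VVar) : Expr .vec
  | un {t : Ty} (o : UnaryOp) (e : Expr t) : Expr t
  | bin {t : Ty} (o : BinaryOp) (e f : Expr t) : Expr t
  | fill (e : Expr .scalar) : Expr .vec
  | sum (e : Expr .vec) : Expr .scalar
  | mulMat (e : Expr .vec) : Expr .vec
  | mulMatT (e : Expr .vec) : Expr .vec

/-- Commands; there is one counter with values in `ℕ`. -/
inductive Cmd
  | setScalar (x : SVar) (e : Expr .scalar)
  | setVec (x : VVar) (e : Expr .vec)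
  | resetCounter
  | incCounter
  | seq (c d : Cmd)
  | ifOdd (c d : Cmd)
  | whileLt (e f : Expr .scalar) (c : Cmd)

noncomputable section

/-- Values of each type, for vectors of length `n`. -/
abbrev Val (n : ℕ) : Ty → Type
  | .scalar => ℝ
  | .vec => Fin n → ℝ

def Val.map {n : ℕ} (g : ℝ → ℝ) : {t : Ty} → Val n t → Val n t
  | .scalar, a => g a
  | .vec, a => fun i => g (a i)

def Val.map₂ {n : ℕ} (g : ℝ → ℝ → ℝ) : {t : Ty} → Val n t → Val n t → Val n t
  | .scalar, a, b => g a b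
  | .vec, a, b => fun i => g (a i) (b i)

def UnaryOp.eval : UnaryOp → ℝ → ℝ
  | .log, x => Real.log x
  | .abs, x => |x|

def BinaryOp.eval : BinaryOp → ℝ → ℝ → ℝ
  | .add, x, y => x + y
  | .sub, x, y => x - y
  | .mul, x, y => x * y
  | .div, x, y => x / y

/-- The memory of a program working with vectors of length `n`. -/
structure State (n : ℕ) where
  scalar : SVar → ℝ
  vec : VVar → Fin n → ℝ
  counter : ℕ

variable {n : ℕ}

/-- The value of an expression when the matrix is `A`. -/
def Expr.eval (A : Matrix (Fin n) (Fin n) ℝ) (s : State n) : {t : Ty} → Expr t → Val n t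
  | _, .lit k => (k : ℝ)
  | _, .dim => (n : ℝ)
  | _, .svar x => s.scalar x
  | _, .vvar x => s.vec x
  | _, .un o e => Val.map o.eval (e.eval A s)
  | _, .bin o e f => Val.map₂ o.eval (e.eval A s) (f.eval A s)
  | _, .fill e => fun _ => e.eval A s
  | _, .sum e => ∑ i, (show Fin n → ℝ from e.eval A s) i
  | _, .mulMat e => A.mulVec (e.eval A s)
  | _, .mulMatT e => A.transpose.mulVec (e.eval A s)

/-- The number of scalars in a value of the given type. -/
def Ty.size (n : ℕ) : Ty → ℕ
  | .scalar => 1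
  | .vec => n

/-- The number of steps needed to evaluate an expression. -/
def Expr.cost (n T : ℕ) : {t : Ty} → Expr t → ℕ
  | _, .lit _ => 1
  | _, .dim => 1
  | _, .svar _ => 1
  | _, .vvar _ => n
  | t, .un _ e => t.size n + e.cost n T
  | t, .bin _ e f => t.size n + e.cost n T + f.cost n T
  | _, .fill e => n + e.cost n T
  | _, .sum e => n + e.cost n T
  | _, .mulMat e => T + e.cost n T
  | _, .mulMatT e => T + e.cost n T

/-- `Exec A T c s s' k`: with matrix `A`, whose products with vectors cost `T` steps, the command
`c` started in `s` halts in `s'` after `k` steps. -/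
inductive Exec (A : Matrix (Fin n) (Fin n) ℝ) (T : ℕ) : Cmd → State n → State n → ℕ → Prop
  | setScalar (x : SVar) (e : Expr .scalar) (s : State n) :
      Exec A T (.setScalar x e) s
        { s with scalar := Function.update s.scalar x (e.eval A s) } (1 + e.cost n T)
  | setVec (x : VVar) (e : Expr .vec) (s : State n) :
      Exec A T (.setVec x e) s
        { s with vec := Function.update s.vec x (e.eval A s) } (n + e.cost n T)
  | resetCounter (s : State n) : Exec A T .resetCounter s { s with counter := 0 } 1
  | incCounter (s : State n) :
      Exec A T .incCounter s { s with counter := s.counter + 1 } 1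
  | seq {c d : Cmd} {s s' s'' : State n} {k l : ℕ}
      (hc : Exec A T c s s' k) (hd : Exec A T d s' s'' l) : Exec A T (.seq c d) s s'' (k + l)
  | ifOdd_true {c d : Cmd} {s s' : State n} {k : ℕ}
      (h : Odd s.counter) (hc : Exec A T c s s' k) : Exec A T (.ifOdd c d) s s' (1 + k)
  | ifOdd_false {c d : Cmd} {s s' : State n} {k : ℕ}
      (h : ¬ Odd s.counter) (hd : Exec A T d s s' k) : Exec A T (.ifOdd c d) s s' (1 + k)
  | while_done {e f : Expr .scalar} {c : Cmd} {s : State n}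
      (h : ¬ ((e.eval A s : ℝ) < (f.eval A s : ℝ))) :
      Exec A T (.whileLt e f c) s s (1 + e.cost n T + f.cost n T)
  | while_step {e f : Expr .scalar} {c : Cmd} {s s' s'' : State n} {k l : ℕ}
      (h : (e.eval A s : ℝ) < (f.eval A s : ℝ))
      (hc : Exec A T c s s' k) (hw : Exec A T (.whileLt e f c) s' s'' l) :
      Exec A T (.whileLt e f c) s s'' (1 + e.cost n T + f.cost n T + k + l)

/-- The input of the Sinkhorn program: `p`, `q`, `δ` and `η`; all other variables are `0`. -/
def initialState (η δ : ℝ) (p q : Fin n → ℝ) : State n where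
  scalar
    | .delta => δ
    | .eta => η
    | _ => 0
  vec
    | .p => p
    | .q => q
    | _ => 0
  counter := 0

end

/-! ## The Sinkhorn program

The scaling matrices are the diagonal matrices of the vectors `d1` and `d2`. -/

/-- `D₁ A D₂ 1`, computed as `d1 * (A d2)`. -/
def rowExpr : Expr .vec := .bin .mul (.vvar .d1) (.mulMat (.vvar .d2))

/-- `(D₁ A D₂)ᵀ 1`, computed as `d2 * (Aᵀ d1)`. -/
def colExpr : Expr .vec := .bin .mul (.vvar .d2) (.mulMatT (.vvar .d1))

/-- The `ℓ₁` distance of two vector expressions. -/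
def distExpr (e f : Expr .vec) : Expr .scalar := .sum (.un .abs (.bin .sub e f))

/-- `(1 - τ) x + (τ / n) 1`. -/
def smoothExpr (x : VVar) : Expr .vec :=
  .bin .add
    (.bin .mul (.fill (.bin .sub (.lit 1) (.svar .tau))) (.vvar x))
    (.fill (.bin .div (.svar .tau) .dim))

/-- `τ ← δ / 8`, `D₁, D₂ ← I`, `k ← 0`, `p' ← (1 - τ) p + (τ / n) 1`, `q' ← (1 - τ) q + (τ / n) 1`. -/
def setup : Cmd :=
  .seq (.setScalar .tau (.bin .div (.svar .delta) (.lit 8))) <|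
  .seq (.setVec .d1 (.fill (.lit 1))) <|
  .seq (.setVec .d2 (.fill (.lit 1))) <|
  .seq .resetCounter <|
  .seq (.setVec .p' (smoothExpr .p))
    (.setVec .q' (smoothExpr .q))

/-- While the `ℓ₁` distance of the marginals of `D₁ A D₂` to `p'` and `q'` exceeds `δ / 2`:
increase `k`, then renormalize the rows if `k` is odd and the columns if `k` is even. -/
def scalingLoop : Cmd :=
  .whileLt (.bin .div (.svar .delta) (.lit 2))
    (.bin .add (distExpr rowExpr (.vvar .p')) (distExpr colExpr (.vvar .q'))) <|
    .seq .incCounter <|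
    .ifOdd
      (.setVec .d1 (.bin .div (.vvar .p') (.mulMat (.vvar .d2))))
      (.setVec .d2 (.bin .div (.vvar .q') (.mulMatT (.vvar .d1))))

/-- `Ŵ ← η⁻¹ (∑ i, log (D₁)ᵢᵢ (D₁ A D₂ 1)ᵢ + ∑ j, log (D₂)ⱼⱼ ((D₁ A D₂)ᵀ 1)ⱼ)`. -/
def costEstimate : Cmd :=
  .setScalar .What <|
    .bin .div
      (.bin .add
        (.sum (.bin .mul (.un .log (.vvar .d1)) rowExpr))
        (.sum (.bin .mul (.un .log (.vvar .d2)) colExpr)))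
      (.svar .eta)

/-- The Sinkhorn program with outputs `d1`, `d2` and `What`. -/
def sinkhorn : Cmd := .seq setup (.seq scalingLoop costEstimate)

end MatVecProgram

/-! Existence and uniqueness follow from compactness of the set of couplings and strict convexity of
`x log x`.

The number of passes is controlled by the dual potential `∑ aᵢ Aᵢⱼ bⱼ - ⟨p, log a⟩ - ⟨q, log b⟩`,
convex in `(log a, log b)`. From the first pass on, the total mass is one, so each further pass
lowers the potential by exactly a relative entropy, hence by at least `E² / 4` with `E` the marginal
error (`sinkhornSeq_decrease`). Conversely, the gradient inequality bounds the gap `g` to a later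
iterate by `2 R E`, where `R` bounds the oscillation of the logarithms of the scalings. This
oscillation is bounded uniformly in the pass because the smoothed targets stay away from zero
(`sinkhornSeq_logSpread`). So while the guard `E > θ` holds, `g` drops by at least `g² / (16 R²)`
and by at least `θ² / 4`. Using the first bound on one half of the passes and the second on the
other half gives `O(R / θ)` passes rather than `O(R / θ²)` (`sq_le_of_decrements`,
`sinkhornSeq_length_le`).

For accuracy, `C` is replaced by the cost `-η⁻¹ log K̃`, which is entrywise within `η⁻¹ δ` of it,
where `δ` is the tolerance. For this cost `Ŵ` is exactly the objective of the scaled matrix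
(`objective_scaling`). That matrix is not much worse than any coupling, by nonnegativity of relative
entropy and the same oscillation bound (`objective_scaling_sub_le`). It is not much better either,
since it can be rounded to a coupling at small cost (`exists_coupling_objective_le`). All errors are
measured in units of `η⁻¹ δ X = ε / 50`, with `X` the `toleranceScale`.

`exec_sinkhorn_iff` transfers these facts about the sequence `sinkhornSeq` to executions of the
program. -/

namespace EntropicOT
noncomputable section
variable {n : ℕ}

/-! ### Couplings: existence and uniqueness of the minimizer. -/

theorem rowSum_apply (P : Matrix (Fin n) (Fin n) ℝ) (i : Fin n) : rowSum P i = ∑ j, P i j := by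
  simp [rowSum, Matrix.mulVec, dotProduct]

theorem colSum_apply (P : Matrix (Fin n) (Fin n) ℝ) (j : Fin n) : colSum P j = ∑ i, P i j := by
  simp [colSum, Matrix.mulVec, dotProduct]

theorem mem_couplings_iff {p q : Fin n → ℝ} {P : Matrix (Fin n) (Fin n) ℝ} :
    P ∈ couplings p q ↔
      (∀ i j, 0 ≤ P i j) ∧ (∀ i, ∑ j, P i j = p i) ∧ ∀ j, ∑ i, P i j = q j := by
  simp [couplings, funext_iff, rowSum_apply, colSum_apply]

theorem sum_eq_one_of_mem_couplings {p q : Fin n → ℝ} (hp : p ∈ stdSimplex ℝ (Fin n))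
    {P : Matrix (Fin n) (Fin n) ℝ} (hP : P ∈ couplings p q) : ∑ i, ∑ j, P i j = 1 := by
  simp [(mem_couplings_iff.1 hP).2.1, hp.2]

theorem vecMulVec_mem_couplings {p q : Fin n → ℝ} (hp : p ∈ stdSimplex ℝ (Fin n))
    (hq : q ∈ stdSimplex ℝ (Fin n)) : Matrix.vecMulVec p q ∈ couplings p q := by
  refine mem_couplings_iff.2 ⟨fun i j => mul_nonneg (hp.1 i) (hq.1 j), fun i => ?_, fun j => ?_⟩
  · simp [Matrix.vecMulVec_apply, ← Finset.mul_sum, hq.2]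
  · simp [Matrix.vecMulVec_apply, ← Finset.sum_mul, hp.2]

theorem isCompact_couplings {p q : Fin n → ℝ} (hp : p ∈ stdSimplex ℝ (Fin n)) :
    IsCompact (couplings p q) := by
  have hbox : IsCompact (Set.univ.pi fun _ : Fin n => Set.univ.pi fun _ : Fin n =>
      Set.Icc (0 : ℝ) 1) :=
    isCompact_univ_pi fun _ => isCompact_univ_pi fun _ => isCompact_Icc
  refine hbox.of_isClosed_subset ?_ ?_
  · have : couplings p q = {P | (∀ i j, 0 ≤ P i j) ∧ (∀ i, ∑ j, P i j = p i) ∧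
        ∀ j, ∑ i, P i j = q j} := Set.ext fun P => mem_couplings_iff
    rw [this]
    simp only [Set.ofPred_and, Set.ofPred_forall]
    refine IsClosed.inter ?_ (IsClosed.inter ?_ ?_)
    · exact isClosed_iInter fun i => isClosed_iInter fun j =>
        isClosed_le continuous_const (by fun_prop)
    · exact isClosed_iInter fun i => isClosed_eq (by fun_prop) continuous_const
    · exact isClosed_iInter fun j => isClosed_eq (by fun_prop) continuous_const
  · intro P hP i _ j _
    have h := mem_couplings_iff.1 hP
    refine ⟨h.1 i j, ?_⟩
    calc P i j ≤ ∑ j, P i j := Finset.single_le_sum (fun j _ => h.1 i j) (Finset.mem_univ j)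
      _ = p i := h.2.1 i
      _ ≤ ∑ i, p i := Finset.single_le_sum (fun i _ => hp.1 i) (Finset.mem_univ i)
      _ = 1 := hp.2

theorem continuous_objective (η : ℝ) (C : Matrix (Fin n) (Fin n) ℝ) :
    Continuous (objective η C) := by
  unfold objective entropy
  have := Real.continuous_negMulLog
  fun_prop

theorem objective_eq_sum (η : ℝ) (C P : Matrix (Fin n) (Fin n) ℝ) :
    objective η C P = ∑ i, ∑ j, (C i j * P i j + η⁻¹ * (P i j * Real.log (P i j))) := by
  simp only [objective, entropy, Real.negMulLog, Finset.sum_add_distrib, Finset.mul_sum]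
  rw [sub_eq_add_neg]
  simp [← Finset.sum_neg_distrib]

theorem strictConvexOn_objective {η : ℝ} (hη : 0 < η) (C : Matrix (Fin n) (Fin n) ℝ)
    (p q : Fin n → ℝ) : StrictConvexOn ℝ (couplings p q) (objective η C) := by
  refine ⟨?_, ?_⟩
  · intro P hP Q hQ a b ha hb hab
    rw [mem_couplings_iff] at *
    refine ⟨fun i j => ?_, fun i => ?_, fun j => ?_⟩
    · have := hP.1 i j
      have := hQ.1 i j
      simp only [Matrix.add_apply, Matrix.smul_apply, smul_eq_mul]
      positivity
    · simp only [Matrix.add_apply, Matrix.smul_apply, smul_eq_mul, Finset.sum_add_distrib,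
        ← Finset.mul_sum, hP.2.1, hQ.2.1]
      rw [← add_mul, hab, one_mul]
    · simp only [Matrix.add_apply, Matrix.smul_apply, smul_eq_mul, Finset.sum_add_distrib,
        ← Finset.mul_sum, hP.2.2, hQ.2.2]
      rw [← add_mul, hab, one_mul]
  · intro P hP Q hQ hPQ a b ha hb hab
    obtain ⟨i₀, j₀, hne⟩ : ∃ i j, P i j ≠ Q i j := by
      by_contra! h
      exact hPQ (Matrix.ext h)
    have hP0 := (mem_couplings_iff.1 hP).1
    have hQ0 := (mem_couplings_iff.1 hQ).1
    have hη' : 0 < η⁻¹ := inv_pos.2 hη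
    have key : ∀ i j, C i j * (a * P i j + b * Q i j)
        + η⁻¹ * ((a * P i j + b * Q i j) * Real.log (a * P i j + b * Q i j))
        ≤ a * (C i j * P i j + η⁻¹ * (P i j * Real.log (P i j)))
          + b * (C i j * Q i j + η⁻¹ * (Q i j * Real.log (Q i j))) := by
      intro i j
      have h := Real.convexOn_mul_log.2 (hP0 i j) (hQ0 i j) ha.le hb.le hab
      simp only [smul_eq_mul] at h
      have := mul_le_mul_of_nonneg_left h hη'.le
      linarith
    -- One entry where `P` and `Q` differ suffices for strictness, since the objective is a sum over
    -- entries.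
    have key' : C i₀ j₀ * (a * P i₀ j₀ + b * Q i₀ j₀)
        + η⁻¹ * ((a * P i₀ j₀ + b * Q i₀ j₀) * Real.log (a * P i₀ j₀ + b * Q i₀ j₀))
        < a * (C i₀ j₀ * P i₀ j₀ + η⁻¹ * (P i₀ j₀ * Real.log (P i₀ j₀)))
          + b * (C i₀ j₀ * Q i₀ j₀ + η⁻¹ * (Q i₀ j₀ * Real.log (Q i₀ j₀))) := by
      have h := Real.strictConvexOn_mul_log.2 (hP0 i₀ j₀) (hQ0 i₀ j₀) hne ha hb hab
      simp only [smul_eq_mul] at h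
      have := mul_lt_mul_of_pos_left h hη'
      linarith
    simp only [objective_eq_sum, smul_eq_mul, Finset.mul_sum, ← Finset.sum_add_distrib,
      Matrix.add_apply, Matrix.smul_apply]
    refine Finset.sum_lt_sum (fun i _ => Finset.sum_le_sum fun j _ => key i j)
      ⟨i₀, Finset.mem_univ _, Finset.sum_lt_sum (fun j _ => key i₀ j)
        ⟨j₀, Finset.mem_univ _, key'⟩⟩

/-- The entropic optimal transport problem has exactly one solution. -/
theorem existsUnique_isOptimalCoupling {η : ℝ} (hη : 0 < η) (C : Matrix (Fin n) (Fin n) ℝ)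
    {p q : Fin n → ℝ} (hp : p ∈ stdSimplex ℝ (Fin n)) (hq : q ∈ stdSimplex ℝ (Fin n)) :
    ∃! P, IsOptimalCoupling η C p q P := by
  obtain ⟨P, hP, hmin⟩ := (isCompact_couplings (q := q) hp).exists_isMinOn
    ⟨_, vecMulVec_mem_couplings hp hq⟩ (continuous_objective η C).continuousOn
  refine ⟨P, ⟨hP, fun Q hQ => hmin hQ⟩, fun Q hQ => ?_⟩
  exact (strictConvexOn_objective hη C p q).eq_of_isMinOn (fun R hR => hQ.2 R hR) hmin hQ.1 hP


/-! ### The dual potential: gradient inequality and decrease under normalization. -/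

/-- The row marginals of `D₁ A D₂` for the diagonal scalings `a` and `b`. -/
def scaledRow (A : Matrix (Fin n) (Fin n) ℝ) (a b : Fin n → ℝ) : Fin n → ℝ :=
  fun i => a i * A.mulVec b i

theorem scaledRow_apply (A : Matrix (Fin n) (Fin n) ℝ) (a b : Fin n → ℝ) (i : Fin n) :
    scaledRow A a b i = ∑ j, a i * A i j * b j := by
  simp [scaledRow, Matrix.mulVec, dotProduct, Finset.mul_sum, mul_assoc]

theorem scaledRow_transpose_apply (A : Matrix (Fin n) (Fin n) ℝ) (a b : Fin n → ℝ) (j : Fin n) :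
    scaledRow A.transpose b a j = ∑ i, a i * A i j * b j := by
  rw [scaledRow_apply]
  exact Finset.sum_congr rfl fun i _ => by simp [Matrix.transpose_apply]; ring

theorem sum_scaledRow_transpose (A : Matrix (Fin n) (Fin n) ℝ) (a b : Fin n → ℝ) :
    ∑ j, scaledRow A.transpose b a j = ∑ i, scaledRow A a b i := by
  simp_rw [scaledRow_transpose_apply, scaledRow_apply]
  exact Finset.sum_comm

theorem mulVec_pos [NeZero n] {A : Matrix (Fin n) (Fin n) ℝ} (hA : ∀ i j, 0 < A i j)
    {b : Fin n → ℝ} (hb : ∀ j, 0 < b j) (i : Fin n) : 0 < A.mulVec b i :=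
  Finset.sum_pos (fun j _ => mul_pos (hA i j) (hb j)) Finset.univ_nonempty

/-- The dual objective of matrix scaling with target marginals `p` and `q`. -/
def dualPotential (A : Matrix (Fin n) (Fin n) ℝ) (p q a b : Fin n → ℝ) : ℝ :=
  ∑ i, scaledRow A a b i - ∑ i, p i * Real.log (a i) - ∑ j, q j * Real.log (b j)

/-- This symmetry lets column passes be treated as row passes for the transposed matrix. -/
theorem dualPotential_transpose (A : Matrix (Fin n) (Fin n) ℝ) (p q a b : Fin n → ℝ) :
    dualPotential A.transpose q p b a = dualPotential A p q a b := by
  unfold dualPotential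
  rw [sum_scaledRow_transpose]
  ring

/-- The distance of the marginals of `D₁ A D₂` to `p` and `q`. -/
def marginalError (A : Matrix (Fin n) (Fin n) ℝ) (p q a b : Fin n → ℝ) : ℝ :=
  l1 (scaledRow A a b - p) + l1 (scaledRow A.transpose b a - q)

theorem marginalError_transpose (A : Matrix (Fin n) (Fin n) ℝ) (p q a b : Fin n → ℝ) :
    marginalError A.transpose q p b a = marginalError A p q a b := by
  simp [marginalError, add_comm]

theorem l1_nonneg (v : Fin n → ℝ) : 0 ≤ l1 v := Finset.sum_nonneg fun _ _ => abs_nonneg _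

theorem l1_sub_le (u v w : Fin n → ℝ) : l1 (u - w) ≤ l1 (u - v) + l1 (v - w) := by
  simp only [l1, ← Finset.sum_add_distrib, Pi.sub_apply]
  exact Finset.sum_le_sum fun i _ => abs_sub_le _ _ _

theorem abs_sum_sub_sum_le_l1 (v w : Fin n → ℝ) : |∑ i, v i - ∑ i, w i| ≤ l1 (v - w) := by
  rw [← Finset.sum_sub_distrib]
  exact Finset.abs_sum_le_sum_abs _ _

/-- Convexity of the dual objective in the logarithms of the scalings. -/
theorem dualPotential_sub_le {A : Matrix (Fin n) (Fin n) ℝ} (hA : ∀ i j, 0 < A i j)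
    (p q : Fin n → ℝ) {a b a' b' : Fin n → ℝ} (ha : ∀ i, 0 < a i) (hb : ∀ i, 0 < b i)
    (ha' : ∀ i, 0 < a' i) (hb' : ∀ i, 0 < b' i) :
    dualPotential A p q a b - dualPotential A p q a' b' ≤
      ∑ i, (scaledRow A a b i - p i) * (Real.log (a i) - Real.log (a' i))
      + ∑ j, (scaledRow A.transpose b a j - q j) * (Real.log (b j) - Real.log (b' j)) := by
  have key : ∀ i j, a i * A i j * b j - a' i * A i j * b' j ≤
      a i * A i j * b j * (Real.log (a i) - Real.log (a' i))
      + a i * A i j * b j * (Real.log (b j) - Real.log (b' j)) := by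
    intro i j
    -- This is `1 + y ≤ exp y` at `y = log (a' b' / (a b))`, to be weighted by the current entry `a
    -- A b`.
    have h := Real.log_le_sub_one_of_pos
      (div_pos (mul_pos (ha' i) (hb' j)) (mul_pos (ha i) (hb j)))
    rw [Real.log_div (mul_pos (ha' i) (hb' j)).ne' (mul_pos (ha i) (hb j)).ne',
      Real.log_mul (ha' i).ne' (hb' j).ne', Real.log_mul (ha i).ne' (hb j).ne'] at h
    have h2 := mul_le_mul_of_nonneg_left h
      (mul_pos (mul_pos (ha i) (hA i j)) (hb j)).le
    have h3 : a i * A i j * b j * (a' i * b' j / (a i * b j) - 1) =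
        a' i * A i j * b' j - a i * A i j * b j := by
      have := (ha i).ne'
      have := (hb j).ne'
      field_simp
    rw [h3] at h2
    linarith
  have hsum := Finset.sum_le_sum fun i (_ : i ∈ Finset.univ) =>
    Finset.sum_le_sum fun j (_ : j ∈ Finset.univ) => key i j
  have e1 : ∑ i, ∑ j, a i * A i j * b j * (Real.log (a i) - Real.log (a' i)) =
      ∑ i, scaledRow A a b i * (Real.log (a i) - Real.log (a' i)) := by
    simp only [scaledRow_apply, Finset.sum_mul]
  have e2 : ∑ i, ∑ j, a i * A i j * b j * (Real.log (b j) - Real.log (b' j)) =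
      ∑ j, scaledRow A.transpose b a j * (Real.log (b j) - Real.log (b' j)) := by
    rw [Finset.sum_comm]
    simp only [scaledRow_transpose_apply, Finset.sum_mul]
  simp only [Finset.sum_add_distrib, Finset.sum_sub_distrib, e1, e2] at hsum
  simp only [dualPotential, sub_mul, mul_sub, Finset.sum_sub_distrib, scaledRow_apply] at hsum ⊢
  linarith

/-- The relative entropy dominates the squared `ℓ₁` distance. -/
theorem sq_l1_le_sum_mul_log_div {p r : Fin n → ℝ} (hp : ∀ i, 0 < p i) (hr : ∀ i, 0 < r i)
    (hp1 : ∑ i, p i = 1) (hr1 : ∑ i, r i = 1) :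
    l1 (r - p) ^ 2 / 4 ≤ ∑ i, p i * Real.log (p i / r i) := by
  have hsp : ∀ i, √(p i) ^ 2 = p i := fun i => Real.sq_sqrt (hp i).le
  have hsr : ∀ i, √(r i) ^ 2 = r i := fun i => Real.sq_sqrt (hr i).le
  have h1 : ∑ i, (√(r i) - √(p i)) ^ 2 ≤ ∑ i, p i * Real.log (p i / r i) := by
    -- Relative entropy dominates the squared Hellinger distance: `log x ≤ x - 1` at `x = √(r / p)`.
    have key : ∀ i, 2 * p i - 2 * (√(p i) * √(r i)) ≤ p i * Real.log (p i / r i) := by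
      intro i
      have h := Real.log_le_sub_one_of_pos
        (div_pos (Real.sqrt_pos.2 (hr i)) (Real.sqrt_pos.2 (hp i)))
      rw [Real.log_div (Real.sqrt_pos.2 (hr i)).ne' (Real.sqrt_pos.2 (hp i)).ne',
        Real.log_sqrt (hr i).le, Real.log_sqrt (hp i).le] at h
      rw [Real.log_div (hp i).ne' (hr i).ne']
      have h2 := mul_le_mul_of_nonneg_left h (hp i).le
      have h3 : p i * (√(r i) / √(p i) - 1) = √(p i) * √(r i) - p i := by
        have h4 := (Real.sqrt_pos.2 (hp i)).ne'
        field_simp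
        rw [← hsp i, Real.sqrt_sq (Real.sqrt_nonneg _)]
        ring
      rw [h3] at h2
      linarith
    calc ∑ i, (√(r i) - √(p i)) ^ 2 = ∑ i, (r i + p i - 2 * (√(p i) * √(r i))) :=
          Finset.sum_congr rfl fun i _ => by
            rw [← hsp i, ← hsr i, Real.sqrt_sq (Real.sqrt_nonneg _),
              Real.sqrt_sq (Real.sqrt_nonneg _)]
            ring
      _ = ∑ i, (2 * p i - 2 * (√(p i) * √(r i))) := by
          simp only [Finset.sum_sub_distrib, Finset.sum_add_distrib, ← Finset.mul_sum, hp1, hr1]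
          ring
      _ ≤ _ := Finset.sum_le_sum fun i _ => key i
  -- Cauchy–Schwarz on `|r - p| = |√r - √p| (√r + √p)`; the second factor contributes the constant
  -- `4`.
  have h2 : l1 (r - p) ^ 2 ≤
      (∑ i, (√(r i) - √(p i)) ^ 2) * ∑ i, (√(r i) + √(p i)) ^ 2 := by
    have e : l1 (r - p) = ∑ i, |√(r i) - √(p i)| * (√(r i) + √(p i)) := by
      refine Finset.sum_congr rfl fun i _ => ?_
      rw [← abs_of_nonneg (add_nonneg (Real.sqrt_nonneg (r i)) (Real.sqrt_nonneg (p i))),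
        ← abs_mul]
      congr 1
      rw [Pi.sub_apply]
      linarith [hsp i, hsr i, sq_sub_sq (√(r i)) (√(p i))]
    rw [e]
    refine (Finset.sum_mul_sq_le_sq_mul_sq _ _ _).trans_eq ?_
    simp
  have h3 : ∑ i, (√(r i) + √(p i)) ^ 2 ≤ 4 := by
    calc ∑ i, (√(r i) + √(p i)) ^ 2 ≤ ∑ i, (2 * r i + 2 * p i) :=
          Finset.sum_le_sum fun i _ => by
            nlinarith [hsp i, hsr i, sq_nonneg (√(r i) - √(p i))]
      _ = 4 := by
          simp only [Finset.sum_add_distrib, ← Finset.mul_sum, hp1, hr1]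
          norm_num
  have h4 : 0 ≤ ∑ i, (√(r i) - √(p i)) ^ 2 := Finset.sum_nonneg fun _ _ => sq_nonneg _
  nlinarith

theorem scaledRow_div {A : Matrix (Fin n) (Fin n) ℝ} {b : Fin n → ℝ}
    (h : ∀ i, 0 < A.mulVec b i) (p : Fin n → ℝ) :
    scaledRow A (fun i => p i / A.mulVec b i) b = p :=
  funext fun i => div_mul_cancel₀ _ (h i).ne'

/-- Normalizing the rows decreases the dual objective. -/
theorem dualPotential_rowUpdate [NeZero n] {A : Matrix (Fin n) (Fin n) ℝ}
    (hA : ∀ i j, 0 < A i j) {p q a b : Fin n → ℝ} (hp : ∀ i, 0 < p i) (hp1 : ∑ i, p i = 1)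
    (hq1 : ∑ i, q i = 1) (ha : ∀ i, 0 < a i) (hb : ∀ i, 0 < b i)
    (hcol : scaledRow A.transpose b a = q) :
    marginalError A p q a b ^ 2 / 4 ≤ dualPotential A p q a b -
      dualPotential A p q (fun i => p i / A.mulVec b i) b := by
  have hpos := mulVec_pos hA hb
  have hr1 : ∑ i, scaledRow A a b i = 1 := by
    rw [← sum_scaledRow_transpose, hcol, hq1]
  have h := sq_l1_le_sum_mul_log_div (r := scaledRow A a b) hp
    (fun i => mul_pos (ha i) (hpos i)) hp1 hr1
  have hE : marginalError A p q a b = l1 (scaledRow A a b - p) := by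
    simp [marginalError, hcol, l1]
  rw [hE]
  refine h.trans_eq ?_
  unfold dualPotential
  -- Both scalings have mass one, so the mass terms cancel and the decrease is exactly the relative
  -- entropy of `p` with respect to the current row marginal.
  rw [hr1, scaledRow_div hpos, hp1]
  have : ∀ i, p i * Real.log (p i / scaledRow A a b i) =
      p i * Real.log (p i / A.mulVec b i) - p i * Real.log (a i) := by
    intro i
    rw [scaledRow, Real.log_div (hp i).ne' (mul_pos (ha i) (hpos i)).ne',
      Real.log_mul (ha i).ne' (hpos i).ne', Real.log_div (hp i).ne' (hpos i).ne']
    ring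
  simp only [this, Finset.sum_sub_distrib]
  ring

/-! ### Oscillation of the scalings and the decrement recurrence. -/

/-- The logarithms of the entries of `a` differ by at most `R`. -/
def LogSpread (R : ℝ) (a : Fin n → ℝ) : Prop := ∀ i i', Real.log (a i) - Real.log (a i') ≤ R

/-- Each `log (A b)ᵢ` lies between `lo + log ∑ b` and `hi + log ∑ b`. The unknown size of `b`
cancels in differences, so the bound does not depend on `b`. -/
theorem logSpread_rowUpdate [NeZero n] {A : Matrix (Fin n) (Fin n) ℝ} (hA : ∀ i j, 0 < A i j)
    {lo hi t : ℝ} (hlo : ∀ i j, lo ≤ Real.log (A i j)) (hhi : ∀ i j, Real.log (A i j) ≤ hi)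
    {p b : Fin n → ℝ} (ht : 0 < t) (hpt : ∀ i, t ≤ p i) (hp1 : ∀ i, p i ≤ 1)
    (hb : ∀ i, 0 < b i) :
    LogSpread (hi - lo + Real.log (1 / t)) (fun i => p i / A.mulVec b i) := by
  intro i i'
  have hpos := mulVec_pos hA hb
  have hp : ∀ i, 0 < p i := fun i => ht.trans_le (hpt i)
  have hS : 0 < ∑ j, b j := Finset.sum_pos (fun j _ => hb j) Finset.univ_nonempty
  have h1 : ∀ i, lo + Real.log (∑ j, b j) ≤ Real.log (A.mulVec b i) := by
    intro i
    rw [← Real.log_exp lo, ← Real.log_mul (Real.exp_pos _).ne' hS.ne']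
    refine Real.log_le_log (by positivity) ?_
    rw [Finset.mul_sum]
    exact Finset.sum_le_sum fun j _ => mul_le_mul_of_nonneg_right
      ((Real.le_log_iff_exp_le (hA i j)).1 (hlo i j)) (hb j).le
  have h2 : ∀ i, Real.log (A.mulVec b i) ≤ hi + Real.log (∑ j, b j) := by
    intro i
    rw [← Real.log_exp hi, ← Real.log_mul (Real.exp_pos _).ne' hS.ne']
    refine Real.log_le_log (hpos i) ?_
    rw [Finset.mul_sum, Matrix.mulVec, dotProduct]
    exact Finset.sum_le_sum fun j _ => mul_le_mul_of_nonneg_right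
      ((Real.log_le_iff_le_exp (hA i j)).1 (hhi i j)) (hb j).le
  rw [Real.log_div (hp i).ne' (hpos i).ne', Real.log_div (hp i').ne' (hpos i').ne', one_div,
    Real.log_inv]
  have h3 : Real.log (p i) ≤ 0 := Real.log_nonpos (hp i).le (hp1 i)
  have h4 : Real.log t ≤ Real.log (p i') := Real.log_le_log ht (hpt i')
  linarith [h1 i, h2 i']

/-- Weights of total zero do not see constants, so `u` may be recentred at one of its values. Only
its oscillation matters, not its size. -/
theorem abs_sum_mul_le_of_spread [NeZero n] {w u : Fin n → ℝ} {R : ℝ} (hw : ∑ i, w i = 0)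
    (hu : ∀ i i', u i - u i' ≤ R) : |∑ i, w i * u i| ≤ R * l1 w := by
  have e : ∑ i, w i * u i = ∑ i, w i * (u i - u 0) := by
    simp [mul_sub, ← Finset.sum_mul, hw]
  rw [e, l1, Finset.mul_sum]
  refine (Finset.abs_sum_le_sum_abs _ _).trans (Finset.sum_le_sum fun i _ => ?_)
  rw [abs_mul, mul_comm]
  exact mul_le_mul_of_nonneg_right (abs_le.2 ⟨by linarith [hu 0 i], hu i 0⟩) (abs_nonneg _)

theorem dualPotential_sub_le_of_logSpread [NeZero n] {A : Matrix (Fin n) (Fin n) ℝ}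
    (hA : ∀ i j, 0 < A i j) {p q a b a' b' : Fin n → ℝ} {R : ℝ}
    (hp1 : ∑ i, p i = 1) (hq1 : ∑ i, q i = 1)
    (ha : ∀ i, 0 < a i) (hb : ∀ i, 0 < b i) (ha' : ∀ i, 0 < a' i) (hb' : ∀ i, 0 < b' i)
    (hmass : ∑ i, scaledRow A a b i = 1)
    (hRa : LogSpread R a) (hRb : LogSpread R b) (hRa' : LogSpread R a') (hRb' : LogSpread R b') :
    dualPotential A p q a b - dualPotential A p q a' b' ≤ 2 * R * marginalError A p q a b := by
  have h1 := abs_sum_mul_le_of_spread (w := scaledRow A a b - p)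
    (u := fun i => Real.log (a i) - Real.log (a' i)) (R := 2 * R)
    (by simp [hp1, hmass]) (fun i i' => by linarith [hRa i i', hRa' i' i])
  have h2 := abs_sum_mul_le_of_spread (w := scaledRow A.transpose b a - q)
    (u := fun i => Real.log (b i) - Real.log (b' i)) (R := 2 * R)
    (by simp [hq1, hmass, sum_scaledRow_transpose])
    (fun i i' => by linarith [hRb i i', hRb' i' i])
  have h := dualPotential_sub_le hA p q ha hb ha' hb'
  rw [marginalError, mul_add]
  exact h.trans (add_le_add ((le_abs_self _).trans h1) ((le_abs_self _).trans h2))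

/-- A nonnegative sequence whose decrements are at least `α * g k ^ 2` and at least `β` is short. -/
theorem sq_le_of_decrements {g : ℕ → ℝ} {α β : ℝ} (hα : 0 < α) (hβ : 0 < β) {N : ℕ}
    (hg : ∀ k ≤ N, 0 ≤ g k) (h1 : ∀ k < N, α * g k ^ 2 ≤ g k - g (k + 1))
    (h2 : ∀ k < N, β ≤ g k - g (k + 1)) : (N : ℝ) ^ 2 ≤ 1 + 4 / (α * β) := by
  -- The discrete analogue of `g' ≤ -α g²`, whose solutions decay like `1 / (α m)`.
  have hA : ∀ m ≤ N, α * m * g m ≤ 1 := by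
    intro m
    induction m with
    | zero => intro _; simp
    | succ m ih =>
      intro hm
      have h := ih (by omega)
      have ha := h1 m (by omega)
      have hb := hg m (by omega)
      have hc := hg (m + 1) hm
      push_cast
      have hmn : (0 : ℝ) ≤ m := by positivity
      set x := g m
      set y := g (m + 1)
      have hyx : y ≤ x - α * x ^ 2 := by linarith
      have : α * (m + 1) * y ≤ α * (m + 1) * (x - α * x ^ 2) :=
        mul_le_mul_of_nonneg_left hyx (by positivity)
      refine this.trans ?_
      have hz : 0 ≤ α * x := by positivity
      have hw : 0 ≤ α * m * x := by positivity
      have e : α * (m + 1) * (x - α * x ^ 2) =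
          1 - ((1 - α * m * x) * (1 - α * x) + (α * x) ^ 2) := by ring
      rw [e]
      rcases le_total (α * x) 1 with h1 | h1
      · nlinarith [mul_nonneg (sub_nonneg.2 h) (sub_nonneg.2 h1), sq_nonneg (α * x)]
      · nlinarith [mul_nonneg hw (sub_nonneg.2 h1)]
  have hB : ∀ j m, m + j ≤ N → j * β ≤ g m - g (m + j) := by
    intro j
    induction j with
    | zero => intro m _; simp
    | succ j ih =>
      intro m hm
      have h := ih m (by omega)
      have h' := h2 (m + j) (by omega)
      push_cast
      rw [← add_assoc]
      linarith
  -- The first `m` steps bring `g` below `1 / (α m)`; the remaining `j` steps each remove at least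
  -- `β`. Hence `m j ≤ 1 / (α β)`.
  obtain ⟨m, hm⟩ : ∃ m, N = m + m ∨ N = m + m + 1 := ⟨N / 2, by omega⟩
  obtain ⟨j, hj, hN⟩ : ∃ j, N = m + j ∧ (j = m ∨ j = m + 1) := by
    rcases hm with h | h
    · exact ⟨m, h, Or.inl rfl⟩
    · exact ⟨m + 1, by omega, Or.inr rfl⟩
  have h := hB j m hj.ge
  have h' := hA m (by omega)
  have hend := hg (m + j) hj.ge
  have hm0 : (0 : ℝ) ≤ m := by positivity
  have hmj : (m : ℝ) * j * (α * β) ≤ 1 := by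
    have : α * m * (j * β) ≤ α * m * g m :=
      mul_le_mul_of_nonneg_left (by linarith) (by positivity)
    nlinarith
  have hmj' : (m : ℝ) * j ≤ 1 / (α * β) := (le_div_iff₀ (by positivity)).2 hmj
  have e : 4 / (α * β) = 4 * (1 / (α * β)) := by ring
  rw [e]
  have hNr : (N : ℝ) = m + j := by exact_mod_cast hj
  rw [hNr]
  -- Here `N² = 4 m j + (j - m)²`, so the extra `1` accounts for odd `N`.
  rcases hN with h | h
  · subst h; nlinarith
  · have : (j : ℝ) = m + 1 := by exact_mod_cast h
    rw [this] at hmj' ⊢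
    nlinarith

/-! ### The Sinkhorn iterates and the number of passes. -/

/-- One pass of Sinkhorn's alternating normalization: rows for odd `k`, columns for even `k`. -/
def sinkhornStep (A : Matrix (Fin n) (Fin n) ℝ) (p q : Fin n → ℝ) (k : ℕ)
    (x : (Fin n → ℝ) × (Fin n → ℝ)) : (Fin n → ℝ) × (Fin n → ℝ) :=
  if Odd k then (fun i => p i / A.mulVec x.2 i, x.2)
  else (x.1, fun j => q j / A.transpose.mulVec x.1 j)

/-- The scalings after `k` passes. -/
def sinkhornSeq (A : Matrix (Fin n) (Fin n) ℝ) (p q : Fin n → ℝ) :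
    ℕ → (Fin n → ℝ) × (Fin n → ℝ)
  | 0 => (fun _ => 1, fun _ => 1)
  | k + 1 => sinkhornStep A p q (k + 1) (sinkhornSeq A p q k)

section Iteration

variable {A : Matrix (Fin n) (Fin n) ℝ} {p q : Fin n → ℝ}

theorem sinkhornSeq_pos [NeZero n] (hA : ∀ i j, 0 < A i j) (hp : ∀ i, 0 < p i)
    (hq : ∀ i, 0 < q i) (k : ℕ) :
    (∀ i, 0 < (sinkhornSeq A p q k).1 i) ∧ ∀ j, 0 < (sinkhornSeq A p q k).2 j := by
  induction k with
  | zero => simp [sinkhornSeq]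
  | succ k ih =>
    rw [sinkhornSeq, sinkhornStep]
    split_ifs
    · exact ⟨fun i => div_pos (hp i) (mulVec_pos hA ih.2 i), ih.2⟩
    · exact ⟨ih.1, fun j => div_pos (hq j) (mulVec_pos (fun i j => hA j i) ih.1 j)⟩

theorem sinkhornSeq_logSpread [NeZero n] (hA : ∀ i j, 0 < A i j) {lo hi t : ℝ}
    (hlo : ∀ i j, lo ≤ Real.log (A i j)) (hhi : ∀ i j, Real.log (A i j) ≤ hi)
    (ht : 0 < t) (hpt : ∀ i, t ≤ p i) (hp1 : ∀ i, p i ≤ 1)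
    (hqt : ∀ i, t ≤ q i) (hq1 : ∀ i, q i ≤ 1) (k : ℕ) :
    LogSpread (hi - lo + Real.log (1 / t)) (sinkhornSeq A p q k).1 ∧
      LogSpread (hi - lo + Real.log (1 / t)) (sinkhornSeq A p q k).2 := by
  induction k with
  | zero =>
    have h1 := (hlo 0 0).trans (hhi 0 0)
    have h2 : 0 ≤ Real.log (1 / t) :=
      Real.log_nonneg ((one_le_div ht).2 ((hpt 0).trans (hp1 0)))
    have : LogSpread (n := n) (hi - lo + Real.log (1 / t)) (fun _ => 1) := fun i i' => by
      simp only [sub_self]; linarith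
    exact ⟨this, this⟩
  | succ k ih =>
    have hpos := sinkhornSeq_pos hA (fun i => ht.trans_le (hpt i)) (fun i => ht.trans_le (hqt i)) k
    rw [sinkhornSeq, sinkhornStep]
    split_ifs
    · exact ⟨logSpread_rowUpdate hA hlo hhi ht hpt hp1 hpos.2, ih.2⟩
    · exact ⟨ih.1, logSpread_rowUpdate (A := A.transpose) (fun i j => hA j i)
        (fun i j => hlo j i) (fun i j => hhi j i) ht hqt hq1 hpos.1⟩

theorem sinkhornSeq_marginals [NeZero n] (hA : ∀ i j, 0 < A i j) (hp : ∀ i, 0 < p i)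
    (hq : ∀ i, 0 < q i) (k : ℕ) :
    (Odd (k + 1) →
      scaledRow A (sinkhornSeq A p q (k + 1)).1 (sinkhornSeq A p q (k + 1)).2 = p) ∧
    (¬ Odd (k + 1) →
      scaledRow A.transpose (sinkhornSeq A p q (k + 1)).2 (sinkhornSeq A p q (k + 1)).1 = q) := by
  have hpos := sinkhornSeq_pos hA hp hq k
  rw [sinkhornSeq, sinkhornStep]
  constructor
  · intro h
    rw [if_pos h]
    exact scaledRow_div (mulVec_pos hA hpos.2) p
  · intro h
    rw [if_neg h]
    exact scaledRow_div (mulVec_pos (fun i j => hA j i) hpos.1) q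

/-- The pass just performed makes one marginal exact. The index starts at one because the initial
all-ones scalings are not normalized. -/
theorem sinkhornSeq_mass [NeZero n] (hA : ∀ i j, 0 < A i j) (hp : ∀ i, 0 < p i)
    (hq : ∀ i, 0 < q i) (hp1 : ∑ i, p i = 1) (hq1 : ∑ i, q i = 1) (k : ℕ) :
    ∑ i, scaledRow A (sinkhornSeq A p q (k + 1)).1 (sinkhornSeq A p q (k + 1)).2 i = 1 := by
  have h := sinkhornSeq_marginals hA hp hq k
  by_cases hk : Odd (k + 1)
  · rw [h.1 hk, hp1]
  · rw [← sum_scaledRow_transpose, h.2 hk, hq1]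

theorem sinkhornSeq_decrease [NeZero n] (hA : ∀ i j, 0 < A i j) (hp : ∀ i, 0 < p i)
    (hq : ∀ i, 0 < q i) (hp1 : ∑ i, p i = 1) (hq1 : ∑ i, q i = 1) (k : ℕ) :
    marginalError A p q (sinkhornSeq A p q (k + 1)).1 (sinkhornSeq A p q (k + 1)).2 ^ 2 / 4 ≤
      dualPotential A p q (sinkhornSeq A p q (k + 1)).1 (sinkhornSeq A p q (k + 1)).2 -
      dualPotential A p q (sinkhornSeq A p q (k + 2)).1 (sinkhornSeq A p q (k + 2)).2 := by
  have h := sinkhornSeq_marginals hA hp hq k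
  have hpos := sinkhornSeq_pos hA hp hq (k + 1)
  rw [sinkhornSeq.eq_2 A p q (k + 1), sinkhornStep]
  by_cases hk : Odd (k + 1)
  · rw [if_neg (by rw [Nat.not_odd_iff_even]; exact hk.add_one)]
    have := dualPotential_rowUpdate (A := A.transpose) (fun i j => hA j i) hq hq1 hp1
      hpos.2 hpos.1 (by simpa using h.1 hk)
    simpa only [dualPotential_transpose, marginalError_transpose] using this
  · rw [if_pos (Nat.not_odd_iff_even.1 hk).add_one]
    exact dualPotential_rowUpdate hA hp hp1 hq1 hpos.1 hpos.2 (h.2 hk)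

/-- Sinkhorn's algorithm reaches marginal error `θ` after `O(R / θ)` passes. -/
theorem sinkhornSeq_length_le [NeZero n] (hA : ∀ i j, 0 < A i j) {lo hi t θ R : ℝ}
    (hlo : ∀ i j, lo ≤ Real.log (A i j)) (hhi : ∀ i j, Real.log (A i j) ≤ hi)
    (ht : 0 < t) (hpt : ∀ i, t ≤ p i) (hp1 : ∑ i, p i = 1)
    (hqt : ∀ i, t ≤ q i) (hq1 : ∑ i, q i = 1) (hθ : 0 < θ)
    (hR : hi - lo + Real.log (1 / t) ≤ R) (hR0 : 0 < R) {N : ℕ}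
    (hN : ∀ k < N, θ < marginalError A p q (sinkhornSeq A p q k).1 (sinkhornSeq A p q k).2) :
    (N : ℝ) ≤ 2 + 16 * R / θ := by
  have hp : ∀ i, 0 < p i := fun i => ht.trans_le (hpt i)
  have hq : ∀ i, 0 < q i := fun i => ht.trans_le (hqt i)
  have hple : ∀ i, p i ≤ 1 := fun i =>
    hp1 ▸ Finset.single_le_sum (fun i _ => (hp i).le) (Finset.mem_univ i)
  have hqle : ∀ i, q i ≤ 1 := fun i =>
    hq1 ▸ Finset.single_le_sum (fun i _ => (hq i).le) (Finset.mem_univ i)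
  -- The potential estimates need mass one and so start after the first pass; that pass is counted
  -- separately.
  rcases N with _ | N
  · have : 0 ≤ 16 * R / θ := by positivity
    push_cast
    linarith
  set E : ℕ → ℝ := fun k =>
    marginalError A p q (sinkhornSeq A p q k).1 (sinkhornSeq A p q k).2 with hE
  set D : ℕ → ℝ := fun k =>
    dualPotential A p q (sinkhornSeq A p q k).1 (sinkhornSeq A p q k).2 with hD
  have hdec : ∀ k, E (k + 1) ^ 2 / 4 ≤ D (k + 1) - D (k + 2) := fun k =>
    sinkhornSeq_decrease hA hp hq hp1 hq1 k
  have hspread := fun k => sinkhornSeq_logSpread hA hlo hhi ht hpt hple hqt hqle k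
  have hpos := fun k => sinkhornSeq_pos hA hp hq k
  have hE0 : ∀ k, 0 ≤ E k := fun k => add_nonneg (l1_nonneg _) (l1_nonneg _)
  -- The comparison point is the last iterate, not a minimizer of the potential: it obeys the same
  -- oscillation bound, and no optimal scalings are needed.
  have hgap : ∀ k, D (k + 1) - D (N + 1) ≤ 2 * R * E (k + 1) := by
    intro k
    refine (dualPotential_sub_le_of_logSpread hA hp1 hq1 (hpos _).1 (hpos _).2 (hpos _).1
      (hpos _).2 (sinkhornSeq_mass hA hp hq hp1 hq1 k) (hspread _).1 (hspread _).2 (hspread _).1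
      (hspread _).2).trans ?_
    exact mul_le_mul_of_nonneg_right (by linarith) (hE0 _)
  have hanti : Antitone fun k => D (k + 1) :=
    antitone_nat_of_succ_le fun k => by
      have := hdec k
      have := sq_nonneg (E (k + 1))
      show D (k + 2) ≤ D (k + 1)
      linarith
  -- `α` comes from inserting `E ≥ g / (2 R)` into the decrement `E² / 4`, and `β` from inserting `E
  -- > θ`.
  have hmain := sq_le_of_decrements (g := fun k => D (k + 1) - D (N + 1)) (N := N)
    (α := 1 / (16 * R ^ 2)) (β := θ ^ 2 / 4) (by positivity) (by positivity)
    (fun k hk => sub_nonneg.2 (hanti hk))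
    (fun k hk => by
      have h1 := hgap k
      have h0 : 0 ≤ D (k + 1) - D (N + 1) := sub_nonneg.2 (hanti hk.le)
      have h2 : (D (k + 1) - D (N + 1)) ^ 2 ≤ (2 * R * E (k + 1)) ^ 2 :=
        pow_le_pow_left₀ h0 h1 2
      have h3 : 1 / (16 * R ^ 2) * (2 * R * E (k + 1)) ^ 2 = E (k + 1) ^ 2 / 4 := by
        field_simp; ring
      have h4 := mul_le_mul_of_nonneg_left h2 (by positivity : 0 ≤ 1 / (16 * R ^ 2))
      have := hdec k
      show _ ≤ D (k + 1) - D (N + 1) - (D (k + 2) - D (N + 1))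
      linarith)
    (fun k hk => by
      have h1 : θ < E (k + 1) := hN (k + 1) (by omega)
      have := hdec k
      show _ ≤ D (k + 1) - D (N + 1) - (D (k + 2) - D (N + 1))
      nlinarith)
  have e : 4 / (1 / (16 * R ^ 2) * (θ ^ 2 / 4)) = (16 * R / θ) ^ 2 := by
    field_simp; ring
  rw [e] at hmain
  have hx : 0 ≤ 16 * R / θ := by positivity
  have : (N : ℝ) ≤ 1 + 16 * R / θ := by
    refine le_of_sq_le_sq ?_ (by positivity)
    nlinarith
  push_cast
  linarith

end Iteration

/-- The mixture `(1 - τ) x + (τ / n) 1` of `x` and the uniform vector. -/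
def smooth (τ : ℝ) (x : Fin n → ℝ) : Fin n → ℝ :=
  fun i => (1 - τ) * x i + τ / n

end
end EntropicOT

/-! ### Executions of the program and their step counts. -/

namespace MatVecProgram
noncomputable section
open EntropicOT
variable {n : ℕ} {A : Matrix (Fin n) (Fin n) ℝ} {T : ℕ}

theorem exec_setScalar_iff {x : SVar} {e : Expr .scalar} {s s' : State n} {k : ℕ} :
    Exec A T (.setScalar x e) s s' k ↔
      s' = { s with scalar := Function.update s.scalar x (e.eval A s) } ∧ k = 1 + e.cost n T := by
  constructor
  · rintro ⟨⟩
    exact ⟨rfl, rfl⟩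
  · rintro ⟨rfl, rfl⟩
    exact .setScalar x e s

theorem exec_setVec_iff {x : VVar} {e : Expr .vec} {s s' : State n} {k : ℕ} :
    Exec A T (.setVec x e) s s' k ↔
      s' = { s with vec := Function.update s.vec x (e.eval A s) } ∧ k = n + e.cost n T := by
  constructor
  · rintro ⟨⟩
    exact ⟨rfl, rfl⟩
  · rintro ⟨rfl, rfl⟩
    exact .setVec x e s

theorem exec_resetCounter_iff {s s' : State n} {k : ℕ} :
    Exec A T .resetCounter s s' k ↔ s' = { s with counter := 0 } ∧ k = 1 := by
  constructor
  · rintro ⟨⟩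
    exact ⟨rfl, rfl⟩
  · rintro ⟨rfl, rfl⟩
    exact .resetCounter s

theorem exec_incCounter_iff {s s' : State n} {k : ℕ} :
    Exec A T .incCounter s s' k ↔ s' = { s with counter := s.counter + 1 } ∧ k = 1 := by
  constructor
  · rintro ⟨⟩
    exact ⟨rfl, rfl⟩
  · rintro ⟨rfl, rfl⟩
    exact .incCounter s

theorem exec_seq_iff {c d : Cmd} {s s'' : State n} {m : ℕ} :
    Exec A T (.seq c d) s s'' m ↔
      ∃ s' k l, Exec A T c s s' k ∧ Exec A T d s' s'' l ∧ m = k + l := by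
  constructor
  · rintro ⟨⟩
    exact ⟨_, _, _, ‹_›, ‹_›, rfl⟩
  · rintro ⟨s', k, l, hc, hd, rfl⟩
    exact .seq hc hd

theorem exec_ifOdd_iff {c d : Cmd} {s s' : State n} {m : ℕ} :
    Exec A T (.ifOdd c d) s s' m ↔
      ∃ k, Exec A T (if Odd s.counter then c else d) s s' k ∧ m = 1 + k := by
  constructor
  · intro h
    cases h with
    | ifOdd_true h hc => exact ⟨_, by rwa [if_pos h], rfl⟩
    | ifOdd_false h hd => exact ⟨_, by rwa [if_neg h], rfl⟩
  · rintro ⟨k, h, rfl⟩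
    split_ifs at h with hs
    · exact .ifOdd_true hs h
    · exact .ifOdd_false hs h

/-- A loop whose body deterministically steps through `S` in constant time stops at the first
state violating the guard. -/
theorem exec_whileLt_iff {e f : Expr .scalar} {c : Cmd} {S : ℕ → State n} {b : ℕ}
    (hc : ∀ k s' t, Exec A T c (S k) s' t ↔ s' = S (k + 1) ∧ t = b) {k : ℕ} {s' : State n}
    {t : ℕ} :
    Exec A T (.whileLt e f c) (S k) s' t ↔
      ∃ N, (∀ j < N, (e.eval A (S (k + j)) : ℝ) < (f.eval A (S (k + j)) : ℝ)) ∧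
        ¬ ((e.eval A (S (k + N)) : ℝ) < (f.eval A (S (k + N)) : ℝ)) ∧
        s' = S (k + N) ∧ t = (N + 1) * (1 + e.cost n T + f.cost n T) + N * b := by
  constructor
  · generalize hw : Cmd.whileLt e f c = w
    generalize hs : S k = s
    intro h
    induction h generalizing k with
    | while_done h =>
      cases hw
      subst hs
      exact ⟨0, by simp, by simpa using h, rfl, by simp⟩
    | @while_step _ _ _ s₁ s₂ s₃ l₁ l₂ h hb hw' _ ih =>
      cases hw
      subst hs
      obtain ⟨rfl, rfl⟩ := (hc _ _ _).1 hb
      obtain ⟨N, h1, h2, h3, h4⟩ := ih rfl rfl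
      refine ⟨N + 1, ?_, ?_, ?_, ?_⟩
      · rintro (_ | j) hj
        · simpa using h
        · have := h1 j (by omega)
          rwa [add_right_comm] at this
      · rwa [add_right_comm] at h2
      · rw [h3, add_right_comm, add_assoc]
      · rw [h4]; ring
    | _ => cases hw
  · rintro ⟨N, h1, h2, rfl, rfl⟩
    induction N generalizing k with
    | zero =>
      have := Exec.while_done (T := T) (c := c) h2
      simpa using this
    | succ N ih =>
      have h := ih (k := k + 1)
        (fun j hj => by
          have := h1 (j + 1) (by omega)
          rwa [← add_assoc, add_right_comm] at this)
        (by rwa [← add_assoc, add_right_comm] at h2)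
      have h0 := h1 0 (by omega)
      have := Exec.while_step h0 ((hc k _ _).2 ⟨rfl, rfl⟩) h
      rw [add_right_comm, add_assoc] at this
      have e' : (N + 1 + 1) * (1 + e.cost n T + f.cost n T) + (N + 1) * b =
          1 + e.cost n T + f.cost n T + b + ((N + 1) * (1 + e.cost n T + f.cost n T) + N * b) := by
        ring
      rw [e']
      exact this

/-- The memory of the Sinkhorn program after `k` passes through its loop. -/
def loopState (A : Matrix (Fin n) (Fin n) ℝ) (η δ : ℝ) (p q : Fin n → ℝ) (k : ℕ) : State n where
  scalar
    | .delta => δ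
    | .eta => η
    | .tau => δ / 8
    | .What => 0
  vec
    | .p => p
    | .q => q
    | .p' => smooth (δ / 8) p
    | .q' => smooth (δ / 8) q
    | .d1 => (sinkhornSeq A (smooth (δ / 8) p) (smooth (δ / 8) q) k).1
    | .d2 => (sinkhornSeq A (smooth (δ / 8) p) (smooth (δ / 8) q) k).2
  counter := k

theorem State.ext' {s s' : State n} (h1 : ∀ x, s.scalar x = s'.scalar x)
    (h2 : ∀ x, s.vec x = s'.vec x) (h3 : s.counter = s'.counter) : s = s' := by
  cases s
  cases s'
  obtain rfl := funext h1
  obtain rfl := funext h2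
  obtain rfl := h3
  rfl

variable {η δ : ℝ} {p q : Fin n → ℝ}

theorem exec_setup_iff {s' : State n} {t : ℕ} :
    Exec A T setup (initialState η δ p q) s' t ↔
      s' = loopState A η δ p q 0 ∧ t = 16 * n + 19 := by
  have key : ∃ s₁ s₂ s₃ s₄ s₅ : State n,
      (∀ s k, Exec A T (.setScalar .tau (.bin .div (.svar .delta) (.lit 8)))
        (initialState η δ p q) s k ↔ s = s₁ ∧ k = 4) ∧
      (∀ s k, Exec A T (.setVec .d1 (.fill (.lit 1))) s₁ s k ↔ s = s₂ ∧ k = n + (n + 1)) ∧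
      (∀ s k, Exec A T (.setVec .d2 (.fill (.lit 1))) s₂ s k ↔ s = s₃ ∧ k = n + (n + 1)) ∧
      (∀ s k, Exec A T .resetCounter s₃ s k ↔ s = s₄ ∧ k = 1) ∧
      (∀ s k, Exec A T (.setVec .p' (smoothExpr .p)) s₄ s k ↔
        s = s₅ ∧ k = n + Expr.cost n T (smoothExpr .p)) ∧
      (∀ s k, Exec A T (.setVec .q' (smoothExpr .q)) s₅ s k ↔
        s = loopState A η δ p q 0 ∧ k = n + Expr.cost n T (smoothExpr .q)) := by
    -- The intermediate memories are found by unification; only the final one has to be identified.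
    refine ⟨_, _, _, _, _, fun s k => exec_setScalar_iff, fun s k => exec_setVec_iff,
      fun s k => exec_setVec_iff, fun s k => exec_resetCounter_iff, fun s k => exec_setVec_iff,
      fun s k => ?_⟩
    rw [exec_setVec_iff]
    refine and_congr_left fun _ => ?_
    refine Eq.congr_right (State.ext' (fun x => ?_) (fun x => ?_) rfl)
    · cases x <;> simp [loopState, initialState, Expr.eval, Val.map₂, BinaryOp.eval]
    · cases x <;> simp [loopState, initialState, Expr.eval, Val.map₂, BinaryOp.eval, sinkhornSeq,
        smoothExpr] <;> rfl
  obtain ⟨s₁, s₂, s₃, s₄, s₅, h₁, h₂, h₃, h₄, h₅, h₆⟩ := key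
  have hcost : ∀ x, Expr.cost n T (smoothExpr x) = 5 * n + 6 := fun x => by
    simp only [smoothExpr, Expr.cost, Ty.size]
    omega
  simp only [hcost] at h₅ h₆
  simp only [setup, exec_seq_iff]
  constructor
  · rintro ⟨_, _, _, c₁, ⟨_, _, _, c₂, ⟨_, _, _, c₃, ⟨_, _, _, c₄, ⟨_, _, _, c₅, c₆, rfl⟩, rfl⟩,
      rfl⟩, rfl⟩, rfl⟩
    obtain ⟨rfl, rfl⟩ := (h₁ _ _).1 c₁
    obtain ⟨rfl, rfl⟩ := (h₂ _ _).1 c₂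
    obtain ⟨rfl, rfl⟩ := (h₃ _ _).1 c₃
    obtain ⟨rfl, rfl⟩ := (h₄ _ _).1 c₄
    obtain ⟨rfl, rfl⟩ := (h₅ _ _).1 c₅
    obtain ⟨rfl, rfl⟩ := (h₆ _ _).1 c₆
    exact ⟨rfl, by omega⟩
  · rintro ⟨rfl, rfl⟩
    exact ⟨_, _, _, (h₁ _ _).2 ⟨rfl, rfl⟩, ⟨_, _, _, (h₂ _ _).2 ⟨rfl, rfl⟩,
      ⟨_, _, _, (h₃ _ _).2 ⟨rfl, rfl⟩, ⟨_, _, _, (h₄ _ _).2 ⟨rfl, rfl⟩,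
      ⟨_, _, _, (h₅ _ _).2 ⟨rfl, rfl⟩, (h₆ _ _).2 ⟨rfl, rfl⟩, rfl⟩, rfl⟩, rfl⟩, rfl⟩, by omega⟩

theorem exec_loopBody_iff (k : ℕ) (s' : State n) (t : ℕ) :
    Exec A T (.seq .incCounter
      (.ifOdd
        (.setVec .d1 (.bin .div (.vvar .p') (.mulMat (.vvar .d2))))
        (.setVec .d2 (.bin .div (.vvar .q') (.mulMatT (.vvar .d1))))))
      (loopState A η δ p q k) s' t ↔ s' = loopState A η δ p q (k + 1) ∧ t = 4 * n + T + 2 := by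
  simp only [exec_seq_iff, exec_incCounter_iff, exec_ifOdd_iff]
  have key : ∀ s' l, Exec A T (if Odd (k + 1) then
        (.setVec .d1 (.bin .div (.vvar .p') (.mulMat (.vvar .d2))))
        else (.setVec .d2 (.bin .div (.vvar .q') (.mulMatT (.vvar .d1)))))
        { loopState A η δ p q k with counter := k + 1 } s' l ↔
        s' = loopState A η δ p q (k + 1) ∧ l = 4 * n + T := by
    intro s' l
    split_ifs with h <;> rw [exec_setVec_iff]
    · have e : ({ loopState A η δ p q k with
          counter := k + 1, vec := Function.update (loopState A η δ p q k).vec .d1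
            (Expr.eval A { loopState A η δ p q k with counter := k + 1 }
              (.bin .div (.vvar .p') (.mulMat (.vvar .d2)))) } : State n) =
          loopState A η δ p q (k + 1) := by
        refine State.ext' (fun x => by cases x <;> rfl) (fun x => ?_) rfl
        cases x <;> simp [loopState, sinkhornSeq, sinkhornStep, h, Expr.eval, Val.map₂,
          BinaryOp.eval]
      rw [e]
      simp only [Expr.cost, Ty.size]
      refine and_congr_right fun _ => ?_
      omega
    · have e : ({ loopState A η δ p q k with
          counter := k + 1, vec := Function.update (loopState A η δ p q k).vec .d2
            (Expr.eval A { loopState A η δ p q k with counter := k + 1 }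
              (.bin .div (.vvar .q') (.mulMatT (.vvar .d1)))) } : State n) =
          loopState A η δ p q (k + 1) := by
        refine State.ext' (fun x => by cases x <;> rfl) (fun x => ?_) rfl
        cases x <;> simp [loopState, sinkhornSeq, sinkhornStep, h, Expr.eval, Val.map₂,
          BinaryOp.eval]
      rw [e]
      simp only [Expr.cost, Ty.size]
      refine and_congr_right fun _ => ?_
      omega
  constructor
  · rintro ⟨_, _, _, ⟨rfl, rfl⟩, ⟨l, hl, rfl⟩, rfl⟩
    obtain ⟨rfl, rfl⟩ := (key _ _).1 hl
    exact ⟨rfl, by omega⟩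
  · rintro ⟨rfl, rfl⟩
    exact ⟨_, _, _, ⟨rfl, rfl⟩, ⟨_, (key _ _).2 ⟨rfl, rfl⟩, rfl⟩, by omega⟩

theorem eval_guard (s : State n) :
    (Expr.eval A s (.bin .add (distExpr rowExpr (.vvar .p')) (distExpr colExpr (.vvar .q'))) : ℝ) =
      marginalError A (s.vec .p') (s.vec .q') (s.vec .d1) (s.vec .d2) := by
  simp only [distExpr, rowExpr, colExpr, Expr.eval, Val.map₂, Val.map, BinaryOp.eval,
    UnaryOp.eval, marginalError, l1, scaledRow, Pi.sub_apply]

/-- The value assigned by `costEstimate`. -/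
def costValue (A : Matrix (Fin n) (Fin n) ℝ) (η : ℝ) (a b : Fin n → ℝ) : ℝ :=
  (∑ i, Real.log (a i) * scaledRow A a b i + ∑ j, Real.log (b j) * scaledRow A.transpose b a j) / η

/-- The executions of the Sinkhorn program. -/
theorem exec_sinkhorn_iff {s' : State n} {t : ℕ} :
    Exec A T sinkhorn (initialState η δ p q) s' t ↔
      ∃ N, (∀ k < N, δ / 2 < marginalError A (smooth (δ / 8) p) (smooth (δ / 8) q)
          (sinkhornSeq A (smooth (δ / 8) p) (smooth (δ / 8) q) k).1
          (sinkhornSeq A (smooth (δ / 8) p) (smooth (δ / 8) q) k).2) ∧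
        marginalError A (smooth (δ / 8) p) (smooth (δ / 8) q)
          (sinkhornSeq A (smooth (δ / 8) p) (smooth (δ / 8) q) N).1
          (sinkhornSeq A (smooth (δ / 8) p) (smooth (δ / 8) q) N).2 ≤ δ / 2 ∧
        s' = { loopState A η δ p q N with
          scalar := Function.update (loopState A η δ p q N).scalar .What
            (costValue A η (sinkhornSeq A (smooth (δ / 8) p) (smooth (δ / 8) q) N).1
              (sinkhornSeq A (smooth (δ / 8) p) (smooth (δ / 8) q) N).2) } ∧
        t = (16 * n + 19) + ((N + 1) * (14 * n + 2 * T + 5) + N * (4 * n + T + 2)) +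
          (14 * n + 2 * T + 4) := by
  have hcost : ∀ N s' t, Exec A T costEstimate (loopState A η δ p q N) s' t ↔
      s' = { loopState A η δ p q N with
          scalar := Function.update (loopState A η δ p q N).scalar .What
            (costValue A η (sinkhornSeq A (smooth (δ / 8) p) (smooth (δ / 8) q) N).1
              (sinkhornSeq A (smooth (δ / 8) p) (smooth (δ / 8) q) N).2) } ∧
        t = 14 * n + 2 * T + 4 := by
    intro N s' t
    rw [costEstimate, exec_setScalar_iff]
    refine and_congr Iff.rfl ?_
    simp only [rowExpr, colExpr, Expr.cost, Ty.size]
    constructor <;> intro h <;> omega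
  have hloop := fun s' t => exec_whileLt_iff (A := A) (T := T)
    (e := .bin .div (.svar .delta) (.lit 2))
    (f := .bin .add (distExpr rowExpr (.vvar .p')) (distExpr colExpr (.vvar .q')))
    (exec_loopBody_iff (A := A) (T := T) (η := η) (δ := δ) (p := p) (q := q)) (k := 0)
    (s' := s') (t := t)
  simp only [eval_guard, zero_add] at hloop
  have hd : ∀ k, (Expr.eval A (loopState A η δ p q k) (.bin .div (.svar .delta) (.lit 2)) : ℝ) =
      δ / 2 := fun k => by
    simp [Expr.eval, Val.map₂, BinaryOp.eval, loopState]
  have hcosts : 1 + Expr.cost n T (.bin .div (.svar .delta) (.lit 2)) +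
      Expr.cost n T (.bin .add (distExpr rowExpr (.vvar .p')) (distExpr colExpr (.vvar .q'))) =
      14 * n + 2 * T + 5 := by
    simp only [distExpr, rowExpr, colExpr, Expr.cost, Ty.size]
    omega
  simp only [hd, hcosts, not_lt] at hloop
  rw [sinkhorn, exec_seq_iff]
  simp only [exec_setup_iff, exec_seq_iff]
  constructor
  · rintro ⟨_, _, _, ⟨rfl, rfl⟩, ⟨_, _, _, hl, hc, rfl⟩, rfl⟩
    obtain ⟨N, h1, h2, rfl, rfl⟩ := (hloop _ _).1 hl
    obtain ⟨rfl, rfl⟩ := (hcost _ _ _).1 hc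
    exact ⟨N, h1, h2, rfl, by omega⟩
  · rintro ⟨N, h1, h2, rfl, rfl⟩
    exact ⟨_, _, _, ⟨rfl, rfl⟩, ⟨_, _, _, (hloop _ _).2 ⟨N, h1, h2, rfl, rfl⟩,
      (hcost _ _ _).2 ⟨rfl, rfl⟩, rfl⟩, by omega⟩

end
end MatVecProgram

/-! ### The objective of a scaled kernel. -/

namespace EntropicOT
noncomputable section
variable {n : ℕ}

theorem sum_sum_mul_le {M P : Matrix (Fin n) (Fin n) ℝ} {κ : ℝ} (hM : ∀ i j, |M i j| ≤ κ)
    (hP : ∀ i j, 0 ≤ P i j) : |∑ i, ∑ j, M i j * P i j| ≤ κ * ∑ i, ∑ j, P i j := by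
  simp only [Finset.mul_sum]
  refine (Finset.abs_sum_le_sum_abs _ _).trans (Finset.sum_le_sum fun i _ => ?_)
  refine (Finset.abs_sum_le_sum_abs _ _).trans (Finset.sum_le_sum fun j _ => ?_)
  rw [abs_mul, abs_of_nonneg (hP i j)]
  exact mul_le_mul_of_nonneg_right (hM i j) (hP i j)

theorem abs_objective_sub_le {η κ : ℝ} {C C' P : Matrix (Fin n) (Fin n) ℝ}
    (hC : ∀ i j, |C i j - C' i j| ≤ κ) (hP : ∀ i j, 0 ≤ P i j) :
    |objective η C P - objective η C' P| ≤ κ * ∑ i, ∑ j, P i j := by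
  have h := sum_sum_mul_le (M := C - C') hC hP
  simp only [Matrix.sub_apply, sub_mul, Finset.sum_sub_distrib] at h
  rwa [objective, objective, sub_sub_sub_cancel_right]

/-- The cost matrix with kernel `A`. -/
def kernelCost (η : ℝ) (A : Matrix (Fin n) (Fin n) ℝ) : Matrix (Fin n) (Fin n) ℝ :=
  Matrix.of fun i j => -(η⁻¹ * Real.log (A i j))

section Scaling

variable {A : Matrix (Fin n) (Fin n) ℝ} {a b : Fin n → ℝ}

theorem diagonal_mul_mul_diagonal_apply (A : Matrix (Fin n) (Fin n) ℝ) (a b : Fin n → ℝ)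
    (i j : Fin n) :
    (Matrix.diagonal a * A * Matrix.diagonal b) i j = a i * A i j * b j := by
  simp [Matrix.mul_diagonal, Matrix.diagonal_mul]

theorem rowSum_scaling (A : Matrix (Fin n) (Fin n) ℝ) (a b : Fin n → ℝ) :
    rowSum (Matrix.diagonal a * A * Matrix.diagonal b) = scaledRow A a b := by
  ext i
  simp only [rowSum_apply, diagonal_mul_mul_diagonal_apply, scaledRow_apply]

theorem colSum_scaling (A : Matrix (Fin n) (Fin n) ℝ) (a b : Fin n → ℝ) :
    colSum (Matrix.diagonal a * A * Matrix.diagonal b) = scaledRow A.transpose b a := by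
  ext j
  simp only [colSum_apply, diagonal_mul_mul_diagonal_apply, scaledRow_transpose_apply]

theorem log_scaling (hA : ∀ i j, 0 < A i j) (ha : ∀ i, 0 < a i) (hb : ∀ i, 0 < b i) (i j : Fin n) :
    Real.log ((Matrix.diagonal a * A * Matrix.diagonal b) i j) =
      Real.log (a i) + Real.log (A i j) + Real.log (b j) := by
  rw [diagonal_mul_mul_diagonal_apply, Real.log_mul (mul_pos (ha i) (hA i j)).ne' (hb j).ne',
    Real.log_mul (ha i).ne' (hA i j).ne']

theorem sum_sum_add_mul (u v : Fin n → ℝ) (M : Matrix (Fin n) (Fin n) ℝ) :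
    ∑ i, ∑ j, (u i + v j) * M i j = ∑ i, u i * rowSum M i + ∑ j, v j * colSum M j := by
  simp only [add_mul, Finset.sum_add_distrib, rowSum_apply, colSum_apply, Finset.mul_sum]
  congr 1
  exact Finset.sum_comm

/-- For this cost, `-η⁻¹ log A` cancels the kernel part of `η⁻¹ log P`. Only the logarithms of the
two scalings remain, paired with the actual marginals. -/
theorem objective_scaling (hA : ∀ i j, 0 < A i j) (ha : ∀ i, 0 < a i) (hb : ∀ i, 0 < b i)
    (η : ℝ) :
    objective η (kernelCost η A) (Matrix.diagonal a * A * Matrix.diagonal b) =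
      MatVecProgram.costValue A η a b := by
  rw [objective_eq_sum, MatVecProgram.costValue, ← rowSum_scaling, ← colSum_scaling,
    ← sum_sum_add_mul (fun i => Real.log (a i)) (fun j => Real.log (b j)), div_eq_inv_mul]
  simp only [Finset.mul_sum]
  refine Finset.sum_congr rfl fun i _ => Finset.sum_congr rfl fun j _ => ?_
  rw [log_scaling hA ha hb, kernelCost, Matrix.of_apply]
  ring

/-- A scaling of the kernel is nearly optimal among matrices with nearby marginals. -/
theorem objective_scaling_sub_le (hA : ∀ i j, 0 < A i j) (ha : ∀ i, 0 < a i) (hb : ∀ i, 0 < b i)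
    {η : ℝ} (hη : 0 < η) {p q : Fin n → ℝ} {Q : Matrix (Fin n) (Fin n) ℝ}
    (hQ : Q ∈ couplings p q) :
    objective η (kernelCost η A) (Matrix.diagonal a * A * Matrix.diagonal b) -
      objective η (kernelCost η A) Q ≤
      η⁻¹ * ((∑ i, scaledRow A a b i - ∑ i, p i)
        + (∑ i, Real.log (a i) * (scaledRow A a b i - p i)
          + ∑ j, Real.log (b j) * (scaledRow A.transpose b a j - q j))) := by
  set P := Matrix.diagonal a * A * Matrix.diagonal b with hPdef
  obtain ⟨hQ0, hQp, hQq⟩ := hQ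
  have hP : ∀ i j, 0 < P i j := fun i j => by
    rw [hPdef, diagonal_mul_mul_diagonal_apply]
    exact mul_pos (mul_pos (ha i) (hA i j)) (hb j)
  have key : ∀ i j, P i j * Real.log (P i j) - P i j * Real.log (A i j)
      - (Q i j * Real.log (Q i j) - Q i j * Real.log (A i j)) ≤
      (P i j - Q i j) + (Real.log (a i) + Real.log (b j)) * (P - Q) i j := by
    intro i j
    have hlog := log_scaling hA ha hb i j
    rw [← hPdef] at hlog
    -- Entrywise nonnegativity of the relative entropy of `Q` with respect to `P`, for unnormalized
    -- matrices; zero entries of `Q` are treated apart.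
    have h : Q i j * Real.log (P i j) - Q i j * Real.log (Q i j) ≤ P i j - Q i j := by
      rcases (hQ0 i j).eq_or_lt with h0 | h0
      · simpa [← h0] using (hP i j).le
      · have := Real.log_le_sub_one_of_pos (div_pos (hP i j) h0)
        rw [Real.log_div (hP i j).ne' h0.ne'] at this
        have h2 := mul_le_mul_of_nonneg_left this h0.le
        rw [mul_sub, mul_sub, mul_div_cancel₀ _ h0.ne'] at h2
        linarith
    have e : Real.log (A i j) = Real.log (P i j) - (Real.log (a i) + Real.log (b j)) := by
      rw [hlog]; ring
    rw [e, Matrix.sub_apply]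
    linarith
  have hsum := Finset.sum_le_sum fun i (_ : i ∈ Finset.univ) =>
    Finset.sum_le_sum fun j (_ : j ∈ Finset.univ) => key i j
  rw [objective_eq_sum, objective_eq_sum]
  have e1 : ∑ i, ∑ j, (kernelCost η A i j * P i j + η⁻¹ * (P i j * Real.log (P i j))) -
      ∑ i, ∑ j, (kernelCost η A i j * Q i j + η⁻¹ * (Q i j * Real.log (Q i j))) =
      η⁻¹ * ∑ i, ∑ j, (P i j * Real.log (P i j) - P i j * Real.log (A i j)
      - (Q i j * Real.log (Q i j) - Q i j * Real.log (A i j))) := by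
    simp only [← Finset.sum_sub_distrib, Finset.mul_sum]
    refine Finset.sum_congr rfl fun i _ => Finset.sum_congr rfl fun j _ => ?_
    rw [kernelCost, Matrix.of_apply]
    ring
  rw [e1]
  refine mul_le_mul_of_nonneg_left (hsum.trans_eq ?_) (inv_pos.2 hη).le
  simp only [Finset.sum_add_distrib]
  rw [sum_sum_add_mul]
  have hr : rowSum (P - Q) = scaledRow A a b - p := by
    rw [← rowSum_scaling, ← hQp, ← hPdef]
    ext i
    simp [rowSum_apply]
  have hc : colSum (P - Q) = scaledRow A.transpose b a - q := by
    rw [← colSum_scaling, ← hQq, ← hPdef]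
    ext i
    simp [colSum_apply]
  rw [hr, hc]
  simp only [Finset.sum_sub_distrib, ← rowSum_apply]
  rw [hQp, hPdef, rowSum_scaling]
  rfl

end Scaling

/-! ### Rounding to a coupling and the change of entropy. -/

theorem mul_min_one_div {x y : ℝ} (hx : 0 ≤ x) (hy : 0 ≤ y) : x * min 1 (y / x) = min x y := by
  -- At `x = 0` both sides vanish; in the rounding this covers zero rows and columns.
  rcases hx.eq_or_lt with rfl | h
  · simp [hy]
  · rw [mul_min_of_nonneg _ _ hx, mul_one, mul_div_cancel₀ _ h.ne']

/-- Rounding of a nonnegative matrix to a coupling: shrink it, then add a rank one correction. -/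
theorem exists_rounding {P : Matrix (Fin n) (Fin n) ℝ} (hP : ∀ i j, 0 ≤ P i j) {p q : Fin n → ℝ}
    (hp : p ∈ stdSimplex ℝ (Fin n)) (hq : q ∈ stdSimplex ℝ (Fin n)) :
    ∃ S N : Matrix (Fin n) (Fin n) ℝ, (∀ i j, 0 ≤ S i j) ∧ (∀ i j, S i j ≤ P i j) ∧
      (∀ i j, 0 ≤ N i j) ∧ S + N ∈ couplings p q ∧
      ∑ i, ∑ j, P i j - ∑ i, ∑ j, S i j ≤ l1 (rowSum P - p) + l1 (colSum P - q) := by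
  set x : Fin n → ℝ := fun i => min 1 (p i / rowSum P i) with hx
  set c : Fin n → ℝ := fun j => ∑ i, x i * P i j with hc
  set y : Fin n → ℝ := fun j => min 1 (q j / c j) with hy
  set S : Matrix (Fin n) (Fin n) ℝ := Matrix.of fun i j => x i * P i j * y j with hS
  have hr0 : ∀ i, 0 ≤ rowSum P i := fun i => by
    rw [rowSum_apply]; exact Finset.sum_nonneg fun j _ => hP i j
  have hx0 : ∀ i, 0 ≤ x i := fun i => le_min zero_le_one (div_nonneg (hp.1 i) (hr0 i))
  have hx1 : ∀ i, x i ≤ 1 := fun i => min_le_left _ _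
  have hxP : ∀ i j, 0 ≤ x i * P i j := fun i j => mul_nonneg (hx0 i) (hP i j)
  have hc0 : ∀ j, 0 ≤ c j := fun j => Finset.sum_nonneg fun i _ => hxP i j
  have hy0 : ∀ j, 0 ≤ y j := fun j => le_min zero_le_one (div_nonneg (hq.1 j) (hc0 j))
  have hy1 : ∀ j, y j ≤ 1 := fun j => min_le_left _ _
  have hSx : ∀ i j, S i j ≤ x i * P i j := fun i j =>
    mul_le_of_le_one_right (hxP i j) (hy1 j)
  have hS0 : ∀ i j, 0 ≤ S i j := fun i j => mul_nonneg (hxP i j) (hy0 j)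
  have hSP : ∀ i j, S i j ≤ P i j := fun i j =>
    (hSx i j).trans (mul_le_of_le_one_left (hP i j) (hx1 i))
  have hxr : ∀ i, ∑ j, x i * P i j = min (rowSum P i) (p i) := fun i => by
    rw [← Finset.mul_sum, ← rowSum_apply, mul_comm, mul_min_one_div (hr0 i) (hp.1 i)]
  have hSr : ∀ i, ∑ j, S i j ≤ p i := fun i =>
    ((Finset.sum_le_sum fun j _ => hSx i j).trans_eq (hxr i)).trans (min_le_right _ _)
  have hSc : ∀ j, ∑ i, S i j = min (c j) (q j) := fun j => by
    simp only [hS, Matrix.of_apply, ← Finset.sum_mul]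
    exact mul_min_one_div (hc0 j) (hq.1 j)
  have hSc' : ∀ j, ∑ i, S i j ≤ q j := fun j => (hSc j).trans_le (min_le_right _ _)
  -- Both residual marginals `e` and `f` have mass `m`, so `e fᵀ / m` has exactly these marginals.
  -- If `m = 0`, both residuals vanish and division by zero returns the correct value `0`.
  set m : ℝ := 1 - ∑ i, ∑ j, S i j with hm
  set e : Fin n → ℝ := fun i => p i - ∑ j, S i j with he
  set f : Fin n → ℝ := fun j => q j - ∑ i, S i j with hf
  have he0 : ∀ i, 0 ≤ e i := fun i => sub_nonneg.2 (hSr i)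
  have hf0 : ∀ j, 0 ≤ f j := fun j => sub_nonneg.2 (hSc' j)
  have hem : ∑ i, e i = m := by simp [he, hm, hp.2]
  have hfm : ∑ j, f j = m := by
    simp only [hf, hm, Finset.sum_sub_distrib, hq.2]
    rw [Finset.sum_comm]
  have hm0 : 0 ≤ m := hem ▸ Finset.sum_nonneg fun i _ => he0 i
  have hem' : ∀ i, e i * m / m = e i := fun i => by
    rcases eq_or_ne m 0 with h | h
    · have : e i ≤ m := hem ▸ Finset.single_le_sum (fun i _ => he0 i) (Finset.mem_univ i)
      simp only [h, div_zero]
      linarith [he0 i]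
    · exact mul_div_cancel_right₀ _ h
  have hfm' : ∀ j, m * f j / m = f j := fun j => by
    rcases eq_or_ne m 0 with h | h
    · have : f j ≤ m := hfm ▸ Finset.single_le_sum (fun i _ => hf0 i) (Finset.mem_univ j)
      simp only [h, div_zero]
      linarith [hf0 j]
    · exact mul_div_cancel_left₀ _ h
  refine ⟨S, Matrix.of fun i j => e i * f j / m, hS0, hSP,
    fun i j => div_nonneg (mul_nonneg (he0 i) (hf0 j)) hm0,
    mem_couplings_iff.2 ⟨fun i j => add_nonneg (hS0 i j)
      (div_nonneg (mul_nonneg (he0 i) (hf0 j)) hm0), fun i => ?_, fun j => ?_⟩, ?_⟩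
  · simp only [Matrix.add_apply, Matrix.of_apply, Finset.sum_add_distrib, ← Finset.sum_div,
      ← Finset.mul_sum, hfm, hem']
    simp [he]
  · simp only [Matrix.add_apply, Matrix.of_apply, Finset.sum_add_distrib, ← Finset.sum_div,
      ← Finset.sum_mul, hem, hfm']
    simp [hf]
  · have h1 : ∑ i, ∑ j, P i j - ∑ j, c j ≤ l1 (rowSum P - p) := by
      rw [hc, Finset.sum_comm (f := fun j i => x i * P i j), ← Finset.sum_sub_distrib]
      refine Finset.sum_le_sum fun i _ => ?_
      rw [hxr, ← rowSum_apply, Pi.sub_apply]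
      rcases le_total (rowSum P i) (p i) with h | h
      · simp [min_eq_left h]
      · rw [min_eq_right h]; exact le_abs_self _
    have h2 : ∑ j, c j - ∑ i, ∑ j, S i j ≤ l1 (colSum P - q) := by
      rw [Finset.sum_comm (f := fun i j => S i j), ← Finset.sum_sub_distrib]
      refine Finset.sum_le_sum fun j _ => ?_
      rw [hSc, Pi.sub_apply]
      -- The row step only shrinks columns, so clipping them loses no more than the excess of the
      -- original column sums.
      have hcc : c j ≤ colSum P j := by
        rw [colSum_apply]
        exact Finset.sum_le_sum fun i _ => mul_le_of_le_one_left (hP i j) (hx1 i)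
      rcases le_total (c j) (q j) with h | h
      · simp [min_eq_left h]
      · rw [min_eq_right h]; exact (by linarith : _ ≤ _).trans (le_abs_self _)
    linarith

theorem add_mul_log_le {a b : ℝ} (ha : 0 ≤ a) (hb : 0 ≤ b) (hab : a + b ≤ 1) :
    (a + b) * Real.log (a + b) ≤ a * Real.log a + b := by
  have h1 : b * Real.log (a + b) ≤ 0 :=
    mul_nonpos_of_nonneg_of_nonpos hb (Real.log_nonpos (add_nonneg ha hb) hab)
  have h2 : a * Real.log (a + b) ≤ a * Real.log a + b := by
    rcases ha.eq_or_lt with rfl | h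
    · simpa using hb
    · have := Real.log_le_sub_one_of_pos (div_pos (add_pos_of_pos_of_nonneg h hb) h)
      rw [Real.log_div (by positivity) h.ne'] at this
      have h3 := mul_le_mul_of_nonneg_left this h.le
      rw [mul_sub, mul_sub, mul_div_cancel₀ _ h.ne'] at h3
      linarith
  linarith

/-- By superadditivity of `x log x` on nonnegative reals, the left side is at most `-t log t` with
`t = x - a`. Concavity bounds this by a tangent line with a free parameter `s`, so summing over all
entries needs no information on the individual `t`. -/
theorem mul_log_sub_le {a x s : ℝ} (ha : 0 ≤ a) (hax : a ≤ x) (hs : 0 < s) :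
    a * Real.log a - x * Real.log x ≤ (x - a) * Real.log (1 / s) + s := by
  rcases hax.eq_or_lt with rfl | hlt
  · simpa using hs.le
  have ht : 0 < x - a := sub_pos.2 hlt
  have h1 : a * Real.log a ≤ a * Real.log x := by
    rcases ha.eq_or_lt with rfl | h
    · simp
    · exact mul_le_mul_of_nonneg_left (Real.log_le_log h hax) ha
  have h2 : (x - a) * Real.log (x - a) ≤ (x - a) * Real.log x :=
    mul_le_mul_of_nonneg_left (Real.log_le_log ht (by linarith)) ht.le
  have h3 := mul_le_mul_of_nonneg_left (Real.log_le_sub_one_of_pos (div_pos hs ht)) ht.le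
  rw [Real.log_div hs.ne' ht.ne', mul_sub, mul_sub, mul_div_cancel₀ _ ht.ne'] at h3
  rw [one_div, Real.log_inv]
  linarith

/-- Rounding to a coupling increases the objective only slightly. -/
theorem exists_coupling_objective_le [NeZero n] {P : Matrix (Fin n) (Fin n) ℝ}
    (hP : ∀ i j, 0 ≤ P i j) {p q : Fin n → ℝ} (hp : p ∈ stdSimplex ℝ (Fin n))
    (hq : q ∈ stdSimplex ℝ (Fin n)) {δ η : ℝ} (hδ : 0 < δ) (hδ1 : δ ≤ 1) (hη : 0 < η)
    (C : Matrix (Fin n) (Fin n) ℝ)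
    (herr : l1 (rowSum P - p) + l1 (colSum P - q) ≤ δ) :
    ∃ Q ∈ couplings p q, objective η C Q ≤ objective η C P + 3 * δ * ‖C‖
      + η⁻¹ * (δ * (3 + Real.log ((n : ℝ) ^ 2 / δ))) := by
  obtain ⟨S, N, hS0, hSP, hN0, hSN, hD⟩ := exists_rounding hP hp hq
  refine ⟨S + N, hSN, ?_⟩
  have hn : (1 : ℝ) ≤ n := by exact_mod_cast NeZero.one_le
  -- With this choice the `n²` additive terms `s` sum to `δ`.
  set s : ℝ := δ / (n : ℝ) ^ 2 with hs
  have hs0 : 0 < s := by positivity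
  have hs' : 1 / s = (n : ℝ) ^ 2 / δ := by rw [hs, one_div_div]
  have hmassSN := sum_eq_one_of_mem_couplings hp hSN
  have hmassP : 1 - δ ≤ ∑ i, ∑ j, P i j := by
    have h := abs_sum_sub_sum_le_l1 (rowSum P) p
    rw [hp.2] at h
    simp only [rowSum_apply] at h
    have := l1_nonneg (colSum P - q)
    linarith [neg_abs_le (∑ i, ∑ j, P i j - 1)]
  simp only [Matrix.add_apply, Finset.sum_add_distrib] at hmassSN
  have hle1 : ∀ i j, S i j + N i j ≤ 1 := by
    intro i j
    have h := mem_couplings_iff.1 hSN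
    calc (S + N) i j ≤ ∑ j, (S + N) i j :=
          Finset.single_le_sum (fun j _ => h.1 i j) (Finset.mem_univ j)
      _ = p i := h.2.1 i
      _ ≤ ∑ i, p i := Finset.single_le_sum (fun i _ => hp.1 i) (Finset.mem_univ i)
      _ = 1 := hp.2
  have hη' : 0 < η⁻¹ := inv_pos.2 hη
  have key : ∀ i j, (C i j * (S i j + N i j)
      + η⁻¹ * ((S i j + N i j) * Real.log (S i j + N i j)))
      - (C i j * P i j + η⁻¹ * (P i j * Real.log (P i j))) ≤
      ‖C‖ * ((P i j - S i j) + N i j)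
      + η⁻¹ * (N i j + (P i j - S i j) * Real.log (1 / s) + s) := by
    intro i j
    have h1 := add_mul_log_le (hS0 i j) (hN0 i j) (hle1 i j)
    have h2 := mul_log_sub_le (hS0 i j) (hSP i j) hs0
    have h3 : η⁻¹ * ((S i j + N i j) * Real.log (S i j + N i j) - P i j * Real.log (P i j)) ≤
        η⁻¹ * (N i j + (P i j - S i j) * Real.log (1 / s) + s) :=
      mul_le_mul_of_nonneg_left (by linarith) hη'.le
    have hC : |C i j| ≤ ‖C‖ := by
      have := Matrix.norm_entry_le_entrywise_sup_norm C (i := i) (j := j)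
      rwa [Real.norm_eq_abs] at this
    have h4 := mul_le_mul_of_nonneg_right (abs_le.1 hC).2 (hN0 i j)
    have h5 := mul_le_mul_of_nonneg_right (neg_le.1 (abs_le.1 hC).1) (sub_nonneg.2 (hSP i j))
    linarith
  have hsum := Finset.sum_le_sum fun i (_ : i ∈ Finset.univ) =>
    Finset.sum_le_sum fun j (_ : j ∈ Finset.univ) => key i j
  rw [objective_eq_sum, objective_eq_sum]
  simp only [Matrix.add_apply]
  have hns : ∑ _i : Fin n, ∑ _j : Fin n, s = δ := by
    simp only [Finset.sum_const, Finset.card_univ, Fintype.card_fin, nsmul_eq_mul, hs]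
    field_simp
  rw [hs'] at hsum
  have hL : 0 ≤ Real.log ((n : ℝ) ^ 2 / δ) := by
    refine Real.log_nonneg ((one_le_div hδ).2 ?_)
    nlinarith
  set L := Real.log ((n : ℝ) ^ 2 / δ)
  simp only [Finset.sum_sub_distrib, Finset.sum_add_distrib (f := fun i => ∑ j, _),
    Finset.sum_add_distrib, ← Finset.mul_sum, ← Finset.sum_mul, hns] at hsum
  simp only [Finset.sum_add_distrib, ← Finset.mul_sum]
  set mP := ∑ i, ∑ j, P i j
  set mS := ∑ i, ∑ j, S i j
  set mN := ∑ i, ∑ j, N i j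
  -- The removed mass is at most `δ`. As `mP ≥ 1 - δ`, the added mass `mN = 1 - mS` is at most `2
  -- δ`.
  have h6 : ‖C‖ * (mP - mS + mN) ≤ ‖C‖ * (3 * δ) :=
    mul_le_mul_of_nonneg_left (by linarith) (norm_nonneg C)
  have h7 : η⁻¹ * (mN + (mP - mS) * L + δ) ≤ η⁻¹ * (δ * (3 + L)) := by
    refine mul_le_mul_of_nonneg_left ?_ hη'.le
    have : (mP - mS) * L ≤ δ * L := mul_le_mul_of_nonneg_right (by linarith) hL
    linarith
  linarith


/-! ### Smoothed marginals and arithmetic of the tolerance. -/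

theorem smooth_ge {τ : ℝ} (h1 : τ ≤ 1) {x : Fin n → ℝ} (hx : ∀ i, 0 ≤ x i) (i : Fin n) :
    τ / n ≤ smooth τ x i :=
  le_add_of_nonneg_left (mul_nonneg (sub_nonneg.2 h1) (hx i))

theorem sum_smooth [NeZero n] (τ : ℝ) {x : Fin n → ℝ} (hx : ∑ i, x i = 1) :
    ∑ i, smooth τ x i = 1 := by
  have : (n : ℝ) ≠ 0 := NeZero.ne _
  simp only [smooth, Finset.sum_add_distrib, ← Finset.mul_sum, hx, Finset.sum_const,
    Finset.card_univ, Fintype.card_fin, nsmul_eq_mul]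
  field_simp
  ring

theorem l1_smooth_sub_le [NeZero n] {τ : ℝ} (h0 : 0 ≤ τ) {x : Fin n → ℝ}
    (hx : x ∈ stdSimplex ℝ (Fin n)) : l1 (smooth τ x - x) ≤ 2 * τ := by
  have hn : (n : ℝ) ≠ 0 := NeZero.ne _
  calc l1 (smooth τ x - x) ≤ ∑ i, (τ / n + τ * x i) := by
        refine Finset.sum_le_sum fun i _ => ?_
        have h1 : 0 ≤ τ / n := by positivity
        have h2 : 0 ≤ τ * x i := mul_nonneg h0 (hx.1 i)
        rw [Pi.sub_apply, smooth, abs_le]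
        constructor <;> linarith
    _ = 2 * τ := by
        simp only [Finset.sum_add_distrib, ← Finset.mul_sum, hx.2, Finset.sum_const,
          Finset.card_univ, Fintype.card_fin, nsmul_eq_mul]
        field_simp
        ring

/-- The scale `‖C‖ η + log (n / (η ε))` of the tolerance. -/
def toleranceScale (η ε : ℝ) (C : Matrix (Fin n) (Fin n) ℝ) : ℝ :=
  ‖C‖ * η + Real.log (n / (η * ε))

section Tolerance

variable {η ε : ℝ} {C : Matrix (Fin n) (Fin n) ℝ}

theorem log_div_mul_nonneg (hη : 1 ≤ η) (hηn : η ≤ n) (hε : 0 < ε) (hε1 : ε ≤ 1) :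
    0 ≤ Real.log (n / (η * ε)) := by
  refine Real.log_nonneg ((one_le_div (by positivity)).2 ?_)
  nlinarith

theorem le_toleranceScale (hη : 1 ≤ η) (hηn : η ≤ n) (hε : 0 < ε) (hε1 : ε ≤ 1) :
    ‖C‖ * η ≤ toleranceScale η ε C :=
  le_add_of_nonneg_right (log_div_mul_nonneg hη hηn hε hε1)

theorem le_toleranceScale_of_one_le (hη : 1 ≤ η) (hηn : η ≤ n) (hε : 0 < ε) (hε1 : ε ≤ 1)
    (hC : 1 ≤ ‖C‖) : η ≤ toleranceScale η ε C :=
  (le_mul_of_one_le_left (by linarith) hC).trans (le_toleranceScale hη hηn hε hε1)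

/-- The minimum is never attained only by `1`, because `ε η ≤ η ≤ X`. -/
theorem tolerance_eq (hη : 1 ≤ η) (hηn : η ≤ n) (hε : 0 < ε) (hε1 : ε ≤ 1) (hC : 1 ≤ ‖C‖) :
    tolerance η ε C = ε * η / (50 * toleranceScale η ε C) := by
  have h := le_toleranceScale_of_one_le hη hηn hε hε1 hC
  refine min_eq_right ((div_le_one (by linarith [h] : 0 < 50 * toleranceScale η ε C)).2 ?_)
  show ε * η ≤ 50 * toleranceScale η ε C
  nlinarith

theorem tolerance_pos (hη : 1 ≤ η) (hηn : η ≤ n) (hε : 0 < ε) (hε1 : ε ≤ 1) (hC : 1 ≤ ‖C‖) :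
    0 < tolerance η ε C := by
  have h := le_toleranceScale_of_one_le hη hηn hε hε1 hC
  rw [tolerance_eq hη hηn hε hε1 hC]
  have : 0 < toleranceScale η ε C := by linarith
  positivity

theorem tolerance_mul_scale (hη : 1 ≤ η) (hηn : η ≤ n) (hε : 0 < ε) (hε1 : ε ≤ 1)
    (hC : 1 ≤ ‖C‖) : η⁻¹ * (tolerance η ε C * toleranceScale η ε C) = ε / 50 := by
  have h := le_toleranceScale_of_one_le hη hηn hε hε1 hC
  rw [tolerance_eq hη hηn hε hε1 hC]
  have : toleranceScale η ε C ≠ 0 := by linarith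
  have : η ≠ 0 := by linarith
  field_simp

/-- The quotient is `50 X · n / (η ε)`. Its three factors have logarithms at most `5`, `X - 1` and
`X`. -/
theorem log_div_tolerance (hη : 1 ≤ η) (hηn : η ≤ n) (hε : 0 < ε) (hε1 : ε ≤ 1)
    (hC : 1 ≤ ‖C‖) : Real.log (n / tolerance η ε C) ≤ 4 + 2 * toleranceScale η ε C := by
  have h := le_toleranceScale_of_one_le hη hηn hε hε1 hC
  have hX : 0 < toleranceScale η ε C := by linarith
  have hn : (0 : ℝ) < n := by linarith
  have hη0 : 0 < η := by linarith
  have e : (n : ℝ) / tolerance η ε C = 50 * (toleranceScale η ε C * (n / (η * ε))) := by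
    rw [tolerance_eq hη hηn hε hε1 hC]
    field_simp
  rw [e, Real.log_mul (by norm_num) (by positivity), Real.log_mul hX.ne' (by positivity)]
  have h1 := Real.log_le_sub_one_of_pos hX
  have h2 : Real.log (n / (η * ε)) ≤ toleranceScale η ε C :=
    le_add_of_nonneg_left (by positivity)
  have h3 : Real.log 50 ≤ 5 := by
    have : Real.log 50 ≤ Real.log (2 ^ 6) := Real.log_le_log (by norm_num) (by norm_num)
    rw [Real.log_pow] at this
    push_cast at this
    linarith [Real.log_two_lt_d9]
  linarith

theorem log_dim_le_toleranceScale (hη : 1 ≤ η) (hηn : η ≤ n) (hε : 0 < ε) (hε1 : ε ≤ 1)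
    (hC : 1 ≤ ‖C‖) : Real.log n ≤ toleranceScale η ε C := by
  have hn : (0 : ℝ) < n := by linarith
  have hη0 : 0 < η := by linarith
  have e : (n : ℝ) = n / (η * ε) * (η * ε) := by field_simp
  have h1 : Real.log n = Real.log (n / (η * ε)) + Real.log (η * ε) := by
    rw [← Real.log_mul (by positivity) (by positivity), ← e]
  have h2 := Real.log_le_sub_one_of_pos (mul_pos hη0 hε)
  rw [h1, toleranceScale]
  nlinarith

/-- As `log (n / ε) ≥ log 2 ≥ 2 / 3`, the first summand of the scale costs `3 / 2` and the second
costs `1`. This is the only source of a logarithm in the running time. -/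
theorem toleranceScale_le (hn : 2 ≤ n) (hη : 1 ≤ η) (hε : 0 < ε) (hε1 : ε ≤ 1)
    (hC : 1 ≤ ‖C‖) : toleranceScale η ε C ≤ 5 / 2 * (η * ‖C‖ * Real.log (n / ε)) := by
  have hn' : (2 : ℝ) ≤ n := by exact_mod_cast hn
  have h1 : Real.log (n / (η * ε)) ≤ Real.log (n / ε) := by
    refine Real.log_le_log (by positivity) ?_
    refine div_le_div_of_nonneg_left (by positivity) hε ?_
    nlinarith
  have h2 : Real.log 2 ≤ Real.log (n / ε) := by
    refine Real.log_le_log (by norm_num) ((le_div_iff₀ hε).2 ?_)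
    nlinarith
  have h3 : 2 / 3 ≤ Real.log (n / ε) := by linarith [Real.log_two_gt_d9]
  have h4 : 1 ≤ η * ‖C‖ := one_le_mul_of_one_le_of_one_le hη hC
  rw [toleranceScale, mul_comm]
  nlinarith

end Tolerance

end
end EntropicOT

/-! ### Assembly of the theorem. -/

open EntropicOT
theorem mainTheorem2 :
    ∃ (c : ℝ) (m : ℕ), 0 < c ∧
      ∀ (n : ℕ) (η ε : ℝ) (C Kt : Matrix (Fin n) (Fin n) ℝ) (p q : Fin n → ℝ) (Tmult : ℕ),
        2 ≤ n → 1 ≤ η → η ≤ n → 0 < ε → ε ≤ 1 → 1 ≤ ‖C‖ →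
        p ∈ stdSimplex ℝ (Fin n) → q ∈ stdSimplex ℝ (Fin n) →
        (∀ i j, 0 < Kt i j) →
        ‖EntropicOT.logEntries (EntropicOT.kernel η C) - EntropicOT.logEntries Kt‖
          ≤ EntropicOT.tolerance η ε C →
        -- the optimal coupling exists and is unique
        (∃! P, EntropicOT.IsOptimalCoupling η C p q P) ∧
        -- the program halts
        (∃ (s : MatVecProgram.State n) (t : ℕ),
          MatVecProgram.Exec Kt Tmult MatVecProgram.sinkhorn
            (MatVecProgram.initialState η (EntropicOT.tolerance η ε C) p q) s t) ∧
        ∀ (s : MatVecProgram.State n) (t : ℕ),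
          MatVecProgram.Exec Kt Tmult MatVecProgram.sinkhorn
            (MatVecProgram.initialState η (EntropicOT.tolerance η ε C) p q) s t →
          ∀ Pt : Matrix (Fin n) (Fin n) ℝ,
            Pt = Matrix.diagonal (s.vec .d1) * Kt * Matrix.diagonal (s.vec .d2) →
            (∀ i, 0 < s.vec .d1 i) ∧ (∀ j, 0 < s.vec .d2 j) ∧
            EntropicOT.l1 (EntropicOT.rowSum Pt - p) + EntropicOT.l1 (EntropicOT.colSum Pt - q)
              ≤ EntropicOT.tolerance η ε C ∧
            (∀ P, EntropicOT.IsOptimalCoupling η C p q P →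
              |EntropicOT.objective η C P - EntropicOT.objective η C Pt| ≤ ε / 2) ∧
            |s.scalar .What - EntropicOT.objective η C Pt| ≤ ε / 2 ∧
            (t : ℝ) ≤ c * ((n + Tmult) * (η * ‖C‖) / EntropicOT.tolerance η ε C)
              * Real.log (n / ε) ^ m := by
  -- `24000 = 9600 · 5 / 2`: a bound of `9600 X / δ` for the step factor, times the constant of
  -- `toleranceScale_le`.
  refine ⟨24000, 1, by norm_num, ?_⟩
  intro n η ε C Kt p q T hn hη hηn hε hε1 hC hp hq hKt hlog
  have : NeZero n := ⟨by omega⟩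
  have hη0 : 0 < η := by linarith
  have hηi : 0 < η⁻¹ := inv_pos.2 hη0
  have hX := le_toleranceScale_of_one_le hη hηn hε hε1 hC
  have hCX := le_toleranceScale (C := C) hη hηn hε hε1
  have hδ := tolerance_pos hη hηn hε hε1 hC
  have hδ1 : tolerance η ε C ≤ 1 := min_le_left _ _
  have hδX := tolerance_mul_scale hη hηn hε hε1 hC
  have hlogδ := log_div_tolerance hη hηn hε hε1 hC
  have hlogn := log_dim_le_toleranceScale hη hηn hε hε1 hC
  have hXle := toleranceScale_le hn hη hε hε1 hC
  set X := toleranceScale η ε C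
  set δ := tolerance η ε C
  have hX1 : 1 ≤ X := hη.trans hX
  have hn0 : (0 : ℝ) < n := by linarith
  have hn2 : (2 : ℝ) ≤ n := by exact_mod_cast hn
  have hentry : ∀ i j, |-η * C i j - Real.log (Kt i j)| ≤ δ := by
    intro i j
    have h := (Matrix.norm_entry_le_entrywise_sup_norm
      (logEntries (kernel η C) - logEntries Kt) (i := i) (j := j)).trans hlog
    simpa [logEntries, kernel, Real.norm_eq_abs] using h
  have hCentry : ∀ i j, |η * C i j| ≤ ‖C‖ * η := by
    intro i j
    have h := Matrix.norm_entry_le_entrywise_sup_norm C (i := i) (j := j)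
    rw [Real.norm_eq_abs] at h
    rw [abs_mul, abs_of_pos hη0, mul_comm]
    exact mul_le_mul_of_nonneg_right h hη0.le
  have hkc : ∀ i j, |C i j - kernelCost η Kt i j| ≤ η⁻¹ * δ := by
    intro i j
    have e : C i j - kernelCost η Kt i j = -(η⁻¹ * (-η * C i j - Real.log (Kt i j))) := by
      rw [kernelCost, Matrix.of_apply]
      field_simp
      ring
    rw [e, abs_neg, abs_mul, abs_of_pos hηi]
    exact mul_le_mul_of_nonneg_left (hentry i j) hηi.le
  set t₀ : ℝ := δ / 8 / n with ht₀
  have ht₀pos : 0 < t₀ := by positivity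
  have hlogt : Real.log (1 / t₀) ≤ 7 + 2 * X := by
    have e : 1 / t₀ = 8 * (n / δ) := by rw [ht₀]; field_simp
    have h8 : Real.log 8 ≤ 3 := by
      have : Real.log 8 = Real.log (2 ^ 3) := by norm_num
      rw [this, Real.log_pow]
      push_cast
      linarith [Real.log_two_lt_d9]
    rw [e, Real.log_mul (by norm_num) (by positivity)]
    linarith
  have hlo : ∀ i j, -(‖C‖ * η) - 1 ≤ Real.log (Kt i j) := fun i j => by
    linarith [(abs_le.1 (hentry i j)).2, (abs_le.1 (hCentry i j)).2]
  have hhi : ∀ i j, Real.log (Kt i j) ≤ ‖C‖ * η + 1 := fun i j => by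
    linarith [(abs_le.1 (hentry i j)).1, (abs_le.1 (hCentry i j)).1]
  -- The left side is at most `2 X + 2 + 7 + 2 X`, and `X ≥ 1`.
  have hR : ‖C‖ * η + 1 - (-(‖C‖ * η) - 1) + Real.log (1 / t₀) ≤ 13 * X := by linarith
  set p' := smooth (δ / 8) p
  set q' := smooth (δ / 8) q
  have hpt : ∀ i, t₀ ≤ p' i := smooth_ge (by linarith) hp.1
  have hqt : ∀ i, t₀ ≤ q' i := smooth_ge (by linarith) hq.1
  have hp1 : ∑ i, p' i = 1 := sum_smooth _ hp.2
  have hq1 : ∑ i, q' i = 1 := sum_smooth _ hq.2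
  have hp0 : ∀ i, 0 < p' i := fun i => ht₀pos.trans_le (hpt i)
  have hq0 : ∀ i, 0 < q' i := fun i => ht₀pos.trans_le (hqt i)
  have hlen : ∀ N : ℕ, (∀ k < N, δ / 2 < marginalError Kt p' q' (sinkhornSeq Kt p' q' k).1
      (sinkhornSeq Kt p' q' k).2) → (N : ℝ) ≤ 2 + 416 * (X / δ) := by
    intro N hN
    have h := sinkhornSeq_length_le hKt hlo hhi ht₀pos hpt hp1 hqt hq1 (half_pos hδ) hR
      (by positivity) hN
    have e : 16 * (13 * X) / (δ / 2) = 416 * (X / δ) := by field_simp; norm_num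
    rwa [e] at h
  refine ⟨existsUnique_isOptimalCoupling hη0 C hp hq, ?_, ?_⟩
  · have hex : ∃ N, marginalError Kt p' q' (sinkhornSeq Kt p' q' N).1
        (sinkhornSeq Kt p' q' N).2 ≤ δ / 2 := by
      by_contra! h
      obtain ⟨N, hN⟩ := exists_nat_gt (2 + 416 * (X / δ))
      exact absurd (hlen N fun k _ => h k) (not_le.2 hN)
    classical
    exact ⟨_, _, MatVecProgram.exec_sinkhorn_iff.2
      ⟨Nat.find hex, fun k hk => not_le.1 (Nat.find_min hex hk), Nat.find_spec hex, rfl, rfl⟩⟩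
  · intro s t hexec Pt hPt
    obtain ⟨N, hN, hfinal, rfl, ht⟩ := MatVecProgram.exec_sinkhorn_iff.1 hexec
    have hpos := sinkhornSeq_pos hKt hp0 hq0 N
    have hlenN := hlen N hN
    have hspread := sinkhornSeq_logSpread hKt hlo hhi ht₀pos hpt
      (fun i => hp1 ▸ Finset.single_le_sum (fun i _ => (hp0 i).le) (Finset.mem_univ i)) hqt
      (fun i => hq1 ▸ Finset.single_le_sum (fun i _ => (hq0 i).le) (Finset.mem_univ i)) N
    replace hPt : Pt = Matrix.diagonal (sinkhornSeq Kt p' q' N).1 * Kt *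
      Matrix.diagonal (sinkhornSeq Kt p' q' N).2 := hPt
    -- If the loop body never runs, the mass need not be one; then all logarithms of the scalings
    -- are zero.
    have hone : N = 0 ∨ ∑ i, scaledRow Kt (sinkhornSeq Kt p' q' N).1
        (sinkhornSeq Kt p' q' N).2 i = 1 := by
      rcases N with _ | N
      · exact Or.inl rfl
      · exact Or.inr (sinkhornSeq_mass hKt hp0 hq0 hp1 hq1 N)
    have hzero : N = 0 → (∀ i, (sinkhornSeq Kt p' q' N).1 i = 1) ∧
        ∀ i, (sinkhornSeq Kt p' q' N).2 i = 1 := by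
      rintro rfl
      exact ⟨fun _ => rfl, fun _ => rfl⟩
    set a := (sinkhornSeq Kt p' q' N).1
    set b := (sinkhornSeq Kt p' q' N).2
    -- The violated guard contributes `δ / 2`, and smoothing with `τ = δ / 8` contributes `δ / 4`
    -- for each marginal.
    have herr : l1 (scaledRow Kt a b - p) + l1 (scaledRow Kt.transpose b a - q) ≤ δ := by
      have h1 := l1_sub_le (scaledRow Kt a b) p' p
      have h2 := l1_sub_le (scaledRow Kt.transpose b a) q' q
      have h3 := l1_smooth_sub_le (τ := δ / 8) (by linarith) hp
      have h4 := l1_smooth_sub_le (τ := δ / 8) (by linarith) hq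
      unfold marginalError at hfinal
      linarith
    have hmass : ∑ i, scaledRow Kt a b i ≤ 1 + δ := by
      have h := abs_sum_sub_sum_le_l1 (scaledRow Kt a b) p
      rw [hp.2] at h
      linarith [le_abs_self (∑ i, scaledRow Kt a b i - 1),
        l1_nonneg (scaledRow Kt.transpose b a - q)]
    have hrow : rowSum Pt = scaledRow Kt a b := by rw [hPt, rowSum_scaling]
    have hcol : colSum Pt = scaledRow Kt.transpose b a := by rw [hPt, colSum_scaling]
    have hPt0 : ∀ i j, 0 ≤ Pt i j := fun i j => by
      rw [hPt, diagonal_mul_mul_diagonal_apply]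
      exact (mul_pos (mul_pos (hpos.1 i) (hKt i j)) (hpos.2 j)).le
    have herr' : l1 (rowSum Pt - p) + l1 (colSum Pt - q) ≤ δ := by rwa [hrow, hcol]
    have hmassPt : ∑ i, ∑ j, Pt i j ≤ 1 + δ := by
      simpa only [← rowSum_apply, hrow] using hmass
    have hηδ : 0 < η⁻¹ * δ := by positivity
    have hηδX : η⁻¹ * δ * X = ε / 50 := by rw [← hδX]; ring
    have hκ : η⁻¹ * δ ≤ ε / 50 := by
      rw [← hηδX]; exact le_mul_of_one_le_right hηδ.le hX1
    have hCPt : |objective η C Pt - objective η (kernelCost η Kt) Pt| ≤ 2 * (η⁻¹ * δ) := by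
      refine (abs_objective_sub_le hkc hPt0).trans ?_
      rw [mul_comm]
      exact mul_le_mul_of_nonneg_right (by linarith) hηδ.le
    have hWhat : objective η (kernelCost η Kt) Pt = MatVecProgram.costValue Kt η a b := by
      rw [hPt, objective_scaling hKt hpos.1 hpos.2]
    refine ⟨hpos.1, hpos.2, herr', fun P hP => ?_, ?_, ?_⟩
    · rw [abs_le]
      constructor
      · have hdual : ∑ i, Real.log (a i) * (scaledRow Kt a b i - p i)
            + ∑ j, Real.log (b j) * (scaledRow Kt.transpose b a j - q j) ≤ 13 * X * δ := by
          rcases hone with h0 | h1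
          · obtain ⟨ha, hb⟩ := hzero h0
            simp only [ha, hb, Real.log_one, zero_mul, Finset.sum_const_zero, add_zero]
            positivity
          · have g1 := (le_abs_self _).trans (abs_sum_mul_le_of_spread
              (w := scaledRow Kt a b - p) (u := fun i => Real.log (a i))
              (by simp [h1, hp.2]) hspread.1)
            have g2 := (le_abs_self _).trans (abs_sum_mul_le_of_spread
              (w := scaledRow Kt.transpose b a - q) (u := fun i => Real.log (b i))
              (by simp [sum_scaledRow_transpose, h1, hq.2]) hspread.2)
            have g3 := add_le_add g1 g2
            simp only [Pi.sub_apply] at g3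
            rw [← mul_add] at g3
            simp only [mul_comm (Real.log _)]
            refine g3.trans ?_
            refine (mul_le_mul_of_nonneg_right hR
              (add_nonneg (l1_nonneg _) (l1_nonneg _))).trans ?_
            exact mul_le_mul_of_nonneg_left herr (by positivity)
        have h1 := objective_scaling_sub_le hKt hpos.1 hpos.2 hη0 hP.1
        rw [← hPt, hp.2] at h1
        have h2 : η⁻¹ * ((∑ i, scaledRow Kt a b i - 1)
            + (∑ i, Real.log (a i) * (scaledRow Kt a b i - p i)
            + ∑ j, Real.log (b j) * (scaledRow Kt.transpose b a j - q j))) ≤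
            η⁻¹ * (δ + 13 * X * δ) :=
          mul_le_mul_of_nonneg_left (by linarith) hηi.le
        have h3 := abs_objective_sub_le (η := η) hkc (mem_couplings_iff.1 hP.1).1
        rw [sum_eq_one_of_mem_couplings hp hP.1] at h3
        have h4 := (abs_le.1 h3).1
        have h5 := (abs_le.1 hCPt).2
        have h6 : η⁻¹ * (δ + 13 * X * δ) = η⁻¹ * δ + 13 * (ε / 50) := by rw [← hηδX]; ring
        -- Changing the cost on `Pt` and on `P` takes `2` and `1` units of `η⁻¹ δ ≤ ε / 50`, the
        -- mass defect one more, the oscillation term `13 ε / 50`: in all at most `17 ε / 50`.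
        linarith
      · obtain ⟨Q, hQ, hQle⟩ := exists_coupling_objective_le hPt0 hp hq hδ hδ1 hη0 C herr'
        have h1 := hP.2 Q hQ
        have h2 : Real.log ((n : ℝ) ^ 2 / δ) ≤ 4 + 3 * X := by
          have e : (n : ℝ) ^ 2 / δ = n * (n / δ) := by ring
          rw [e, Real.log_mul hn0.ne' (by positivity)]
          linarith
        have h3 : η⁻¹ * (δ * (3 + Real.log ((n : ℝ) ^ 2 / δ))) ≤ 10 * (ε / 50) := by
          rw [← hηδX, ← mul_assoc]
          refine (mul_le_mul_of_nonneg_left (by linarith : _ ≤ 10 * X) hηδ.le).trans_eq ?_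
          ring
        have h4 : 3 * δ * ‖C‖ ≤ 3 * (ε / 50) := by
          have e : 3 * δ * ‖C‖ = 3 * (η⁻¹ * δ * (‖C‖ * η)) := by field_simp
          rw [e, ← hηδX]
          have := mul_le_mul_of_nonneg_left hCX hηδ.le
          linarith
        linarith
    · have h : |MatVecProgram.costValue Kt η a b - objective η C Pt| ≤ ε / 2 := by
        rw [← hWhat, abs_sub_comm]
        linarith
      simpa [MatVecProgram.loopState] using h
    · have hXδ : 1 ≤ X / δ := (one_le_div hδ).2 (hδ1.trans hX1)
      have hT : (0 : ℝ) ≤ T := by positivity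
      have hN0 : (0 : ℝ) ≤ N := by positivity
      -- The exact count is `44 n + 4 T + 28 + N (18 n + 3 T + 7)`; the constants are absorbed by `n
      -- ≥ 2`.
      have h1 : (t : ℝ) ≤ (n + T) * (59 + 22 * N) := by
        rw [ht]
        push_cast
        nlinarith [mul_nonneg hN0 hT, mul_nonneg hN0 (sub_nonneg.2 hn2)]
      -- `9255 = 59 + 22 · 2 + 22 · 416`, using `X / δ ≥ 1`.
      have h2 : (59 + 22 * N : ℝ) ≤ 9255 * (X / δ) := by linarith
      have h3 : X / δ ≤ 5 / 2 * (η * ‖C‖ * Real.log (n / ε)) / δ :=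
        div_le_div_of_nonneg_right hXle hδ.le
      have h4 : 0 ≤ X / δ := by positivity
      calc (t : ℝ) ≤ (n + T) * (59 + 22 * N) := h1
        _ ≤ (n + T) * (9600 * (5 / 2 * (η * ‖C‖ * Real.log (n / ε)) / δ)) :=
          mul_le_mul_of_nonneg_left (by linarith) (by positivity)
        _ = 24000 * ((n + T) * (η * ‖C‖) / δ) * Real.log (n / ε) ^ 1 := by ring
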